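/- Let $m\ge 1$, let $P\in\overline{\mathbb{Q}}[x_1,\dots,x_m]$ be a nonzero polynomial, and let $r=(r_1,\dots,r_m)$ be an $m$-tuple of positive integers with $\deg_{x_h}P\le r_h$ for all $1\le h\le m$. Let $\beta=(\beta_1,\dots,\beta_m)\in\overline{\mathbb{Q}}^m$ and let $0<\eta\le \frac12$ be a real number. Write $h(\alpha)$ for the absolute logarithmic Weil height of an algebraic number $\alpha$, and $$h(P)=\sum_{v\in M_K}\log\max_J|c_J|_v$$ for the absolute logarithmic height of $P=\sum_J c_Jx^J$, where $K$ is a number field containing all coefficients $c_J$, $M_K$ is its set of places, and $|\cdot|_v=\|\cdot\|_v^{[K_v:\mathbb{Q}_v]/[K:\mathbb{Q}]}$ with $\|\cdot\|_v$ extending the standard absolute value of $\mathbb{Q}_v$ (the value does not depend on $K$). For $I=(i_1,\dots,i_m)\in\mathbb{Z}_{\ge0}^m$ put $\partial_I=\frac{1}{i_1!\cdots i_m!}\left(\frac{\partial}{\partial x_1}\right)^{i_1}\cdots\left(\frac{\partial}{\partial x_m}\right)^{i_m}$, and define the index $$\operatorname{Ind}_{\beta,r}(P)=\min\left\{\frac{i_1}{r_1}+\dots+\frac{i_m}{r_m}\;:\;I\in\mathbb{Z}_{\ge0}^m,\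 \partial_IP(\beta)\neq0\right\}.$$ Suppose that $$\frac{r_{j+1}}{r_j}\le\eta^{2^{m-1}}\quad(1\le j\le m-1)\qquad\text{and}\qquad \eta^{2^{m-1}}\min_{1\le h\le m}\bigl(r_h\,h(\beta_h)\bigr)\ge h(P)+2mr_1.$$ Then $\operatorname{Ind}_{\beta,r}(P)\le 2m\eta$. -/

import Mathlib

namespace RothLemma

/-- The field of algebraic numbers. -/
abbrev QBar : Type := AlgebraicClosure ℚ

/-- The number field generated by the coefficients of a polynomial over the algebraic numbers. -/
noncomputable abbrev coeffField {m : ℕ} (P : MvPolynomial (Fin m) QBar) : IntermediateField ℚ QBar :=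
  IntermediateField.adjoin ℚ (P.coeffs : Set QBar)

theorem isIntegral_QBar (x : QBar) : IsIntegral ℚ x := by
  have h : @IsIntegral ℚ QBar _ _ (AlgebraicClosure.instAlgebra ℚ) x :=
    (AlgebraicClosure.isAlgebraic ℚ).isAlgebraic x |>.isIntegral
  convert h
  exact Subsingleton.elim _ _

instance coeffField_finiteDimensional {m : ℕ} (P : MvPolynomial (Fin m) QBar) :
    FiniteDimensional ℚ (coeffField P) :=
  IntermediateField.finiteDimensional_adjoin fun x _ => isIntegral_QBar x

instance coeffField_numberField {m : ℕ} (P : MvPolynomial (Fin m) QBar) :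
    NumberField (coeffField P) where
  to_charZero := inferInstance
  to_finiteDimensional := coeffField_finiteDimensional P

/-- The family of nonzero coefficients of `P`, as elements of the field they generate. -/
noncomputable def coeffFamily {m : ℕ} (P : MvPolynomial (Fin m) QBar) (s : P.support) : coeffField P :=
  ⟨P.coeff s, IntermediateField.subset_adjoin ℚ _
    (Finset.mem_coe.mpr
      (MvPolynomial.coeff_mem_coeffs s.1 (MvPolynomial.mem_support_iff.mp s.2)))⟩

/-- The absolute logarithmic height `h(P) = ∑_v log |P|_v` of a nonzero polynomial with algebraic
coefficients, where `|P|_v` is the maximum of the `v`-adic absolute values of the coefficients.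
`Height.logHeight` is the same sum for the absolute values that are not normalized by the degree
of the number field, so it is divided by that degree. -/
noncomputable def polyHeight {m : ℕ} (P : MvPolynomial (Fin m) QBar) : ℝ :=
  Height.logHeight (coeffFamily P) / (Module.finrank ℚ (coeffField P) : ℝ)

/-- The differential operator `∂_I = (1 / (i₁! ⋯ i_m!)) (∂/∂x₁)^{i₁} ⋯ (∂/∂x_m)^{i_m}`. -/
noncomputable def dividedDeriv {m : ℕ} (I : Fin m → ℕ) (P : MvPolynomial (Fin m) QBar) :
    MvPolynomial (Fin m) QBar :=
  ((∏ h, (Nat.factorial (I h) : QBar))⁻¹) •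
    (List.ofFn fun h : Fin m =>
      ((MvPolynomial.pderiv h).toLinearMap :
        Module.End QBar (MvPolynomial (Fin m) QBar)) ^ I h).prod P

/-- The index of `P` at `β` with respect to the weights `r`: the minimum of the numbers
`i₁/r₁ + ⋯ + i_m/r_m` over all multi-indices `I` with `∂_I P(β) ≠ 0`. -/
noncomputable def index {m : ℕ} (β : Fin m → QBar) (r : Fin m → ℕ)
    (P : MvPolynomial (Fin m) QBar) : ℝ :=
  sInf {t : ℝ | ∃ I : Fin m → ℕ, MvPolynomial.eval β (dividedDeriv I P) ≠ 0 ∧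
    t = ∑ h, (I h : ℝ) / (r h : ℝ)}

end RothLemma

namespace RothLemma

/-! ### Comparison of heights place by place. -/

open Height AdmissibleAbsValues Function

/-! Induction on the number of variables, by Roth's Wronskian method. Write `P` as a shortest sum of
`n` products `φ_j ψ_j`, with `ψ_j` in the last variable and `φ_j` in the others; then `n ≤ ρ + 1`,
where `ρ` is the last `r`. Minimality makes both families linearly independent, so they have nonzero
generalized Wronskians `U` and `V` (`exists_det_hasse_ne_zero`). The product `U V` is a determinant
of divided derivatives of `P` itself, so its height is at most about `n` times that of `P`, whatever
the `φ_j` and `ψ_j` are. Heights add over disjoint variables, which bounds `U` and `V` separately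
(`exists_wronskian_factors`).

If `P` has index `θ`, expanding the determinant shows that `U V` has index at least about `∑_{b<n}
max (θ - b/ρ) 0`: derivatives in the first variables are cheap because `ρ` is small against the
other `r`, and column `b` costs at most `b/ρ`. This sum is at least `n * min (θ/2) (θ²/4)`. From
above, the index of `U` is bounded by induction with `η²` in place of `η`, and the order of `V` by
`exists_coeff_translate_ne_zero_univariate`: a high power of `X - β` cannot divide a polynomial of
small height and degree when `β` has large height. Comparison bounds `θ²` by a multiple of `η²`;
this squaring is the origin of the exponent `2 ^ (m - 1)` (`exists_wt_le`).

The induction runs over a number field with unnormalized heights, and the index is read off as the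
least weight of a monomial in the Taylor expansion at `β`. The absolute heights enter only at the
end. -/

lemma iSup_abv_pos {K ι : Type*} [Field K] [Finite ι] (v : AbsoluteValue K ℝ)
    {x : ι → K} (hx : x ≠ 0) : 0 < ⨆ i, v (x i) := by
  obtain ⟨i, hi⟩ := ne_iff.mp hx
  exact (v.pos hi).trans_le (Finite.le_ciSup_of_le i le_rfl)

section Comparison

variable {K : Type*} [Field K] [AdmissibleAbsValues K] {ι ι' : Type*} [Finite ι] [Finite ι']

lemma hasFiniteMulSupport_iSup {x : ι → K} (hx : x ≠ 0) :
    (fun v : nonarchAbsVal (K := K) ↦ ⨆ i, v.val (x i)).HasFiniteMulSupport := by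
  have h := Set.finite_iUnion fun i : {j // x j ≠ 0} ↦ hasFiniteMulSupport (K := K) i.2
  refine h.subset fun v hv ↦ ?_
  by_contra hcon
  simp only [Set.mem_iUnion, not_exists, mem_mulSupport, not_not] at hcon
  obtain ⟨i, hi⟩ := ne_iff.mp hx
  have : Nonempty ι := ⟨i⟩
  refine hv (le_antisymm (ciSup_le fun j ↦ ?_) (Finite.le_ciSup_of_le i (hcon ⟨i, hi⟩).ge))
  by_cases hj : x j = 0
  · simp [hj]
  · exact (hcon ⟨j, hj⟩).le

/-- A tuple that is dominated, place by place, by the `n`-th power of another one, up to a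
constant at the archimedean places, has a correspondingly bounded height. -/
lemma logHeight_le_of_local {x : ι → K} {y : ι' → K} (hx : x ≠ 0) (hy : y ≠ 0) {C : ℝ}
    (hC : 0 < C) (n : ℕ)
    (harch : ∀ v ∈ archAbsVal (K := K), (⨆ i, v (y i)) ≤ C * (⨆ i, v (x i)) ^ n)
    (hnon : ∀ v ∈ nonarchAbsVal (K := K), (⨆ i, v (y i)) ≤ (⨆ i, v (x i)) ^ n) :
    logHeight y ≤ n * logHeight x + totalWeight K * Real.log C := by
  have key : mulHeight y ≤ C ^ totalWeight K * mulHeight x ^ n := by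
    rw [mulHeight_eq hx, mulHeight_eq hy, mul_pow, ← mul_assoc]
    have h1 : (archAbsVal.map fun v : AbsoluteValue K ℝ ↦ ⨆ i, v (y i)).prod ≤
        C ^ totalWeight K * (archAbsVal.map fun v : AbsoluteValue K ℝ ↦ ⨆ i, v (x i)).prod ^ n := by
      have hcard : C ^ totalWeight K =
          (archAbsVal.map fun _ : AbsoluteValue K ℝ ↦ C).prod := by simp [totalWeight]
      rw [← Multiset.prod_map_pow, hcard, ← Multiset.prod_map_mul]
      refine Multiset.prod_map_le_prod_map₀ _ _ (fun v _ ↦ (iSup_abv_pos v hy).le) harch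
    have h2 : ∏ᶠ v : nonarchAbsVal (K := K), ⨆ i, v.val (y i) ≤
        (∏ᶠ v : nonarchAbsVal (K := K), ⨆ i, v.val (x i)) ^ n := by
      rw [finprod_pow (hasFiniteMulSupport_iSup hx)]
      refine finprod_le_finprod (hasFiniteMulSupport_iSup hy)
        (fun v ↦ (iSup_abv_pos v.val hy).le) ?_ (fun v ↦ hnon v.val v.2)
      exact (hasFiniteMulSupport_iSup hx).subset fun v hv h ↦ hv (by simp [h])
    have h3 : 0 ≤ ∏ᶠ v : nonarchAbsVal (K := K), ⨆ i, v.val (y i) :=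
      finprod_nonneg fun v ↦ (iSup_abv_pos v.val hy).le
    have h4 : 0 ≤ C ^ totalWeight K *
        (archAbsVal.map fun v : AbsoluteValue K ℝ ↦ ⨆ i, v (x i)).prod ^ n :=
      mul_nonneg (pow_nonneg hC.le _) (pow_nonneg (Multiset.prod_map_nonneg
        fun v _ ↦ (iSup_abv_pos v hx).le) _)
    exact mul_le_mul h1 h2 h3 h4
  have hlog := Real.log_le_log (mulHeight_pos y) key
  rw [Real.log_mul (pow_pos hC _).ne' (pow_pos (mulHeight_pos x) _).ne', Real.log_pow,
    Real.log_pow] at hlog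
  simp only [logHeight_eq_log_mulHeight]
  linarith

end Comparison

/-! ### Heights under extension of the number field. -/

section Extension

open NumberField

variable {K L : Type*} [Field K] [NumberField K] [Field L] [NumberField L] [Algebra K L]

/-- The multiplicity of a place counts the embeddings that induce it. Embeddings are convenient
because restriction from `L` to `K` has fibres of constant size, unlike the map on places. -/
lemma prod_infinitePlace_pow_mult (f : AbsoluteValue K ℝ → ℝ) :
    ∏ v : InfinitePlace K, f v.val ^ v.mult = ∏ φ : K →+* ℂ, f (InfinitePlace.mk φ).val := by
  classical
  rw [← Finset.prod_fiberwise Finset.univ (InfinitePlace.mk (K := K))]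
  refine Finset.prod_congr rfl fun w _ ↦ ?_
  rw [Finset.prod_congr rfl (g := fun _ ↦ f w.val), Finset.prod_const,
    InfinitePlace.card_filter_mk_eq]
  intro φ hφ
  rw [(Finset.mem_filter.mp hφ).2]

lemma card_embedding_fiber (φ : K →+* ℂ) [DecidableEq (K →+* ℂ)] :
    (Finset.univ.filter fun ψ : L →+* ℂ ↦ ψ.comp (algebraMap K L) = φ).card =
      Module.finrank K L := by
  let _ := φ.toAlgebra
  have : FiniteDimensional K L := Module.Finite.of_restrictScalars_finite ℚ K L
  rw [← AlgHom.card K L ℂ, ← Fintype.card_subtype]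
  refine Fintype.card_congr ⟨fun ψ ↦ ⟨ψ.1, fun x ↦ ?_⟩, fun ψ ↦ ⟨ψ.toRingHom, ?_⟩, ?_, ?_⟩
  · exact congrFun (congrArg DFunLike.coe ψ.2) x
  · ext x; exact ψ.commutes x
  · intro ψ; rfl
  · intro ψ; rfl

/-- For an integral tuple the finite part of the height is the inverse norm of the ideal spanned by
the entries, and extending an ideal raises its norm to the power `[L : K]`; the splitting of finite
places never has to be examined. -/
lemma mulHeight_algebraMap_integers {ι : Type*} [Finite ι] {x : ι → 𝓞 K} (hx : x ≠ 0) :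
    mulHeight (fun i ↦ algebraMap K L (x i)) =
      mulHeight (fun i ↦ (x i : K)) ^ Module.finrank K L := by
  classical
  have hx1 : (fun i ↦ (x i : K)) ≠ 0 := by
    obtain ⟨i, hi⟩ := ne_iff.mp hx
    exact ne_iff.mpr ⟨i, by simpa using hi⟩
  have hx2 : (fun i ↦ algebraMap K L (x i)) ≠ 0 := by
    obtain ⟨i, hi⟩ := ne_iff.mp hx
    exact ne_iff.mpr ⟨i, by simpa using hi⟩
  let y : ι → 𝓞 L := fun i ↦ algebraMap (𝓞 K) (𝓞 L) (x i)
  have hxy (i : ι) : (y i : L) = algebraMap K L (x i) := rfl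
  have hy : y ≠ 0 := by
    obtain ⟨i, hi⟩ := ne_iff.mp hx
    refine ne_iff.mpr ⟨i, fun h ↦ hi ?_⟩
    have : algebraMap K L (x i) = 0 := by
      rw [← hxy, h]; simp
    simpa using this
  have fK := absNorm_mul_finprod_finitePlace_eq_one hx
  have fL := absNorm_mul_finprod_finitePlace_eq_one hy
  have hI : Ideal.span (Set.range y) =
      (Ideal.span (Set.range x)).map (algebraMap (𝓞 K) (𝓞 L)) := by
    rw [Ideal.map_span, ← Set.range_comp]; rfl
  have hdeg : Module.finrank (𝓞 K) (𝓞 L) = Module.finrank K L :=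
    (IsFractionRing.finrank_eq (𝓞 K) K (𝓞 L) L).symm
  rw [hI, Ideal.absNorm_algebraMap] at fL
  push_cast at fL
  rw [NumberField.mulHeight_eq hx1, NumberField.mulHeight_eq hx2, mul_pow]
  congr 1
  · have e1 := prod_infinitePlace_pow_mult (K := L) fun v ↦ ⨆ i, v (algebraMap K L (x i))
    have e2 := prod_infinitePlace_pow_mult (K := K) fun v ↦ ⨆ i, v (x i : K)
    refine e1.trans (Eq.trans ?_ (congrArg (· ^ Module.finrank K L) e2.symm))
    rw [← Finset.prod_fiberwise Finset.univ (fun ψ : L →+* ℂ ↦ ψ.comp (algebraMap K L)),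
      ← Finset.prod_pow]
    refine Finset.prod_congr rfl fun φ _ ↦ ?_
    rw [Finset.prod_congr rfl (g := fun _ ↦ ⨆ i, (InfinitePlace.mk φ).val (x i : K)),
      Finset.prod_const]
    · exact congrArg _ (card_embedding_fiber φ)
    intro ψ hψ
    rw [← (Finset.mem_filter.mp hψ).2]
    rfl
  · have h1 : (∏ᶠ v : FinitePlace K, ⨆ i, v (x i : K)) =
        ((Ideal.span (Set.range x)).absNorm : ℝ)⁻¹ := eq_inv_of_mul_eq_one_right fK
    have h2 : (∏ᶠ v : FinitePlace L, ⨆ i, v (y i : L)) =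
        (((Ideal.span (Set.range x)).absNorm : ℝ) ^ Module.finrank (𝓞 K) (𝓞 L))⁻¹ :=
      eq_inv_of_mul_eq_one_right fL
    rw [h1, inv_pow, ← hdeg, ← h2]
    rfl

/-- Heights are invariant under scaling, so denominators may be cleared first. -/
theorem mulHeight_algebraMap {ι : Type*} [Finite ι] (x : ι → K) :
    mulHeight (fun i ↦ algebraMap K L (x i)) = mulHeight x ^ Module.finrank K L := by
  by_cases hx : x = 0
  · subst hx
    have : (fun i : ι ↦ algebraMap K L ((0 : ι → K) i)) = 0 := by ext; simp
    rw [this]; simp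
  obtain ⟨b, hb⟩ := IsLocalization.exist_integer_multiples_of_finite (nonZeroDivisors (𝓞 K)) x
  choose y hy using hb
  have hb0 : ((b : 𝓞 K) : K) ≠ 0 := by
    simp
  have hy' : (fun i ↦ (y i : K)) = ((b : 𝓞 K) : K) • x := by
    ext i
    rw [Pi.smul_apply, smul_eq_mul]
    exact (hy i).trans (by rw [Algebra.smul_def])
  have hy0 : y ≠ 0 := by
    rintro rfl
    obtain ⟨i, hi⟩ := ne_iff.mp hx
    have := congrFun hy' i
    simp [hb0] at this
    exact hi this
  have h := mulHeight_algebraMap_integers (L := L) hy0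
  have e : (fun i ↦ algebraMap K L (y i)) =
      (algebraMap K L ((b : 𝓞 K) : K)) • fun i ↦ algebraMap K L (x i) := by
    ext i
    have := congrFun hy' i
    simp only [Pi.smul_apply, smul_eq_mul] at this ⊢
    rw [this, map_mul]
  rw [hy', e, mulHeight_smul_eq_mulHeight _ hb0, mulHeight_smul_eq_mulHeight] at h
  · exact h
  · simp

theorem logHeight_algebraMap {ι : Type*} [Finite ι] (x : ι → K) :
    logHeight (fun i ↦ algebraMap K L (x i)) = Module.finrank K L * logHeight x := by
  rw [logHeight_eq_log_mulHeight, mulHeight_algebraMap, Real.log_pow,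
    ← logHeight_eq_log_mulHeight]

end Extension

end RothLemma

namespace RothLemma

open MvPolynomial Finset

/-! ### Translation of polynomials. -/

section Translate

variable {σ : Type*} {K : Type*} [Field K]

lemma multiIndex_induction {p : (σ →₀ ℕ) → Prop} (zero : p 0)
    (step : ∀ I h, p I → p (I + Finsupp.single h 1)) (I : σ →₀ ℕ) : p I := by
  suffices H : ∀ J, p J → p (J + I) by simpa using H 0 zero
  induction I using Finsupp.induction_linear with
  | zero => simp
  | add f g hf hg => intro J hJ; rw [← add_assoc]; exact hg _ (hf _ hJ)
  | single h n =>
    intro J hJ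
    induction n with
    | zero => simpa using hJ
    | succ n ih => rw [Finsupp.single_add, ← add_assoc]; exact step _ _ ih

/-- Translation of a polynomial by the vector `β`. -/
noncomputable def translate (β : σ → K) : MvPolynomial σ K →ₐ[K] MvPolynomial σ K :=
  aeval fun h ↦ X h + C (β h)

lemma pderiv_translate (β : σ → K) (h : σ) (f : MvPolynomial σ K) :
    pderiv h (translate β f) = translate β (pderiv h f) := by
  classical
  induction f using MvPolynomial.induction_on with
  | C a => simp [translate, algebraMap_eq]
  | add p q hp hq => simp [hp, hq]
  | mul_X p g hp =>
    have hX : translate β (X g : MvPolynomial σ K) = X g + C (β g) := by simp [translate]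
    rw [map_mul, pderiv_mul, pderiv_mul, map_add, map_mul, map_mul, hp, hX]
    congr 2
    by_cases hg : g = h
    · subst hg; simp
    · simp [pderiv_X_of_ne hg]

lemma coeff_zero_translate (β : σ → K) (f : MvPolynomial σ K) :
    coeff 0 (translate β f) = eval β f := by
  induction f using MvPolynomial.induction_on with
  | C a => simp [translate, algebraMap_eq]
  | add p q hp hq => simp [hp, hq]
  | mul_X p g hp =>
    have hX : translate β (X g : MvPolynomial σ K) = X g + C (β g) := by simp [translate]
    rw [← constantCoeff_eq] at hp ⊢
    rw [map_mul, map_mul, map_mul, hp, hX]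
    simp

lemma translate_injective (β : σ → K) : Function.Injective (translate β) := by
  have h : (translate (-β)).comp (translate β) = AlgHom.id K _ := by
    ext g; simp [translate, algebraMap_eq]
  intro f g hfg
  have := congrArg (translate (-β)) hfg
  rwa [← AlgHom.comp_apply, ← AlgHom.comp_apply, h] at this

end Translate

/-! ### Divided derivatives and Taylor expansion. -/

section Hasse

variable {σ : Type*} [Fintype σ] {K : Type*} [Field K]

/-- The divided partial derivative of multi-index `I`. -/
noncomputable def hasse (I : σ →₀ ℕ) : MvPolynomial σ K →ₗ[K] MvPolynomial σ K :=
  (basisMonomials σ K).constr K fun J ↦ monomial (J - I) (∏ h, ((J h).choose (I h) : K))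

lemma hasse_monomial (I J : σ →₀ ℕ) (c : K) :
    hasse I (monomial J c) = monomial (J - I) (c * ∏ h, ((J h).choose (I h) : K)) := by
  have h : monomial J c = c • basisMonomials σ K J := by simp [smul_monomial]
  rw [h, map_smul, hasse, Module.Basis.constr_basis, smul_monomial, smul_eq_mul]

/-- The factors are integers, hence of absolute value at most one at nonarchimedean places. -/
lemma coeff_hasse (I J : σ →₀ ℕ) (f : MvPolynomial σ K) :
    coeff J (hasse I f) = (∏ h, ((J h + I h).choose (I h) : K)) * coeff (J + I) f := by
  classical
  induction f using MvPolynomial.induction_on' with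
  | add p q hp hq => rw [map_add, coeff_add, hp, hq, coeff_add, mul_add]
  | monomial S c =>
    rw [hasse_monomial, coeff_monomial, coeff_monomial]
    by_cases hS : S = J + I
    · subst hS
      simp [mul_comm]
    · rw [if_neg hS, mul_zero]
      split_ifs with h
      · have : ¬ I ≤ S := fun hle ↦ hS (by rw [← h, tsub_add_cancel_of_le hle])
        rw [Finsupp.le_def, not_forall] at this
        obtain ⟨g, hg⟩ := this
        rw [Finset.prod_eq_zero (mem_univ g), mul_zero]
        rw [Nat.choose_eq_zero_of_lt (not_le.mp hg), Nat.cast_zero]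
      · rfl

@[simp]
lemma hasse_zero (f : MvPolynomial σ K) : hasse 0 f = f := by
  ext J
  simp [coeff_hasse]

lemma pderiv_hasse (I : σ →₀ ℕ) (h : σ) (f : MvPolynomial σ K) :
    pderiv h (hasse I f) = ((I h : K) + 1) • hasse (I + Finsupp.single h 1) f := by
  classical
  ext J
  rw [coeff_pderiv, coeff_smul, coeff_hasse, coeff_hasse, smul_eq_mul,
    ← Finset.mul_prod_erase univ _ (mem_univ h), ← Finset.mul_prod_erase univ _ (mem_univ h)]
  have e1 : ∏ g ∈ univ.erase h, (((J g + Finsupp.single h 1 g) + I g).choose (I g) : K) =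
      ∏ g ∈ univ.erase h, ((J g + (I g + Finsupp.single h 1 g)).choose
        (I g + Finsupp.single h 1 g) : K) := by
    refine Finset.prod_congr rfl fun g hg ↦ ?_
    have : h ≠ g := (Finset.ne_of_mem_erase hg).symm
    simp [this]
  have e2 : J + Finsupp.single h 1 + I = J + (I + Finsupp.single h 1) := by
    rw [add_assoc, add_comm (Finsupp.single h 1)]
  have e3 : ((J h + 1 + I h).choose (I h) : K) * (J h + 1) =
      (I h + 1) * ((J h + (I h + 1)).choose (I h + 1) : K) := by
    have := Nat.choose_succ_right_eq (J h + (I h + 1)) (I h)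
    have h2 : J h + (I h + 1) - I h = J h + 1 := by omega
    rw [h2] at this
    have h3 : J h + 1 + I h = J h + (I h + 1) := by omega
    rw [h3, mul_comm ((I h : K) + 1)]
    exact_mod_cast congrArg (Nat.cast (R := K)) this.symm
  simp only [Finsupp.add_apply, Finsupp.single_eq_same] at e1 ⊢
  rw [e1, e2]
  linear_combination (∏ g ∈ univ.erase h, ((J g + (I g + (Finsupp.single h 1) g)).choose
        (I g + (Finsupp.single h 1) g) : K)) * coeff (J + (I + Finsupp.single h 1)) f * e3

variable [CharZero K]

lemma hasse_add_single (I : σ →₀ ℕ) (h : σ) (f : MvPolynomial σ K) :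
    hasse (I + Finsupp.single h 1) f = ((I h : K) + 1)⁻¹ • pderiv h (hasse I f) := by
  rw [pderiv_hasse, smul_smul, inv_mul_cancel₀ (Nat.cast_add_one_ne_zero _), one_smul]

lemma hasse_translate (β : σ → K) (I : σ →₀ ℕ) (f : MvPolynomial σ K) :
    hasse I (translate β f) = translate β (hasse I f) := by
  induction I using multiIndex_induction with
  | zero => simp
  | step I h ih => rw [hasse_add_single, hasse_add_single, ih, pderiv_translate, map_smul]

/-- The Taylor formula. -/
lemma coeff_translate (β : σ → K) (I : σ →₀ ℕ) (f : MvPolynomial σ K) :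
    coeff I (translate β f) = eval β (hasse I f) := by
  rw [← coeff_zero_translate, ← hasse_translate, coeff_hasse]
  simp

end Hasse

/-! ### Lower bounds for the weights of monomials. -/

section Order

variable {σ : Type*} [Fintype σ] {K : Type*} [Field K]

/-- The weight of a multi-index. -/
noncomputable def wt (w : σ → ℝ) (I : σ →₀ ℕ) : ℝ := ∑ h, I h * w h

lemma wt_add (w : σ → ℝ) (I J : σ →₀ ℕ) : wt w (I + J) = wt w I + wt w J := by
  simp [wt, add_mul, Finset.sum_add_distrib]

lemma wt_nonneg {w : σ → ℝ} (hw : ∀ h, 0 ≤ w h) (I : σ →₀ ℕ) : 0 ≤ wt w I :=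
  Finset.sum_nonneg fun h _ ↦ mul_nonneg (Nat.cast_nonneg _) (hw h)

/-- All monomials of `f` have weight at least `t`. -/
def WtGE (w : σ → ℝ) (t : ℝ) (f : MvPolynomial σ K) : Prop :=
  ∀ I, coeff I f ≠ 0 → t ≤ wt w I

lemma WtGE.sum {w : σ → ℝ} {t : ℝ} {ι : Type*} {s : Finset ι} {f : ι → MvPolynomial σ K}
    (hf : ∀ i ∈ s, WtGE w t (f i)) : WtGE w t (∑ i ∈ s, f i) := by
  intro I hI
  rw [coeff_sum] at hI
  obtain ⟨i, hi, h⟩ := Finset.exists_ne_zero_of_sum_ne_zero hI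
  exact hf i hi I h

lemma WtGE.mul {w : σ → ℝ} {t u : ℝ} {f g : MvPolynomial σ K} (hf : WtGE w t f)
    (hg : WtGE w u g) : WtGE w (t + u) (f * g) := by
  classical
  intro I hI
  rw [coeff_mul] at hI
  obtain ⟨x, hx, h⟩ := Finset.exists_ne_zero_of_sum_ne_zero hI
  rw [← mem_antidiagonal.mp hx, wt_add]
  exact add_le_add (hf _ (left_ne_zero_of_mul h)) (hg _ (right_ne_zero_of_mul h))

lemma WtGE.prod {w : σ → ℝ} {ι : Type*} {s : Finset ι} {t : ι → ℝ}
    {f : ι → MvPolynomial σ K} (hf : ∀ i ∈ s, WtGE w (t i) (f i)) :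
    WtGE w (∑ i ∈ s, t i) (∏ i ∈ s, f i) := by
  classical
  induction s using Finset.induction_on with
  | empty =>
    intro I hI
    have : 0 = I := by simpa [coeff_one] using hI
    simp [← this, wt]
  | insert i s hi ih =>
    rw [Finset.sum_insert hi, Finset.prod_insert hi]
    exact (hf i (mem_insert_self i s)).mul (ih fun j hj ↦ hf j (mem_insert_of_mem hj))

/-- Truncation at zero is free because weights are nonnegative. Without it, derivatives of high
order would contribute negative amounts to the bound for a determinant. -/
lemma WtGE.hasse {w : σ → ℝ} {t : ℝ} {f : MvPolynomial σ K} (hw : ∀ h, 0 ≤ w h)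
    (hf : WtGE w t f) (J : σ →₀ ℕ) : WtGE w (max (t - wt w J) 0) (hasse J f) := by
  intro I hI
  rw [coeff_hasse] at hI
  have := hf _ (right_ne_zero_of_mul hI)
  rw [wt_add] at this
  exact max_le (by linarith) (wt_nonneg hw I)

/-- Each term of the expansion takes one entry from every column, so bounds depending only on the
column add up. Negative weights are allowed, which also makes this a tool for degree bounds. -/
lemma WtGE.det {w : σ → ℝ} {n : ℕ} {t : Fin n → ℝ} {M : Matrix (Fin n) (Fin n) (MvPolynomial σ K)}
    (hM : ∀ a b, WtGE w (t b) (M a b)) : WtGE w (∑ b, t b) M.det := by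
  rw [Matrix.det_apply']
  refine WtGE.sum fun τ _ ↦ ?_
  have h1 : WtGE w (∑ b, t b) (∏ i, M (τ i) i) := WtGE.prod fun i _ ↦ hM _ _
  intro I hI
  refine h1 I fun h0 ↦ hI ?_
  rcases Int.units_eq_one_or (Equiv.Perm.sign τ) with h | h <;> simp [h, h0]

end Order

/-! ### Iterated partial derivatives as divided derivatives. -/

section DividedDeriv

lemma pderiv_pow_hasse {σ : Type*} [Fintype σ] {K : Type*} [Field K] {I : σ →₀ ℕ} {h : σ}
    (hI : I h = 0) (n : ℕ) (f : MvPolynomial σ K) :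
    (((pderiv h).toLinearMap : Module.End K (MvPolynomial σ K)) ^ n) (hasse I f) =
      (n.factorial : K) • hasse (I + Finsupp.single h n) f := by
  induction n with
  | zero => simp
  | succ n ih =>
    rw [pow_succ', Module.End.mul_apply, ih, map_smul]
    change _ • pderiv h _ = _
    rw [pderiv_hasse, smul_smul, add_assoc, ← Finsupp.single_add]
    simp [hI, Nat.factorial_succ, mul_comm]

lemma list_prod_pderiv {σ : Type*} [Fintype σ] {K : Type*} [Field K] (I : σ → ℕ)
    (l : List σ) (hl : l.Nodup) (f : MvPolynomial σ K) :
    (l.map fun h ↦ ((pderiv h).toLinearMap : Module.End K (MvPolynomial σ K)) ^ I h).prod f =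
      (l.map fun h ↦ ((I h).factorial : K)).prod •
        hasse (l.map fun h ↦ Finsupp.single h (I h)).sum f := by
  induction l with
  | nil => simp
  | cons a l ih =>
    rw [List.nodup_cons] at hl
    have h0 : (l.map fun h ↦ Finsupp.single h (I h)).sum a = 0 := by
      clear ih
      induction l with
      | nil => simp
      | cons b l ih =>
        simp only [List.mem_cons, not_or, List.nodup_cons] at hl
        have hb : b ≠ a := fun h ↦ hl.1.1 h.symm
        simp [ih ⟨hl.1.2, hl.2.2⟩, hb]
    simp only [List.map_cons, List.prod_cons, List.sum_cons, Module.End.mul_apply]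
    rw [ih hl.2, map_smul, pderiv_pow_hasse h0, smul_smul, mul_comm, add_comm]

lemma dividedDeriv_eq_hasse {m : ℕ} (I : Fin m → ℕ) (P : MvPolynomial (Fin m) QBar) :
    dividedDeriv I P = hasse (Finsupp.equivFunOnFinite.symm I) P := by
  have hsum : ((List.finRange m).map fun h ↦ Finsupp.single h (I h)).sum =
      Finsupp.equivFunOnFinite.symm I := by
    rw [← List.ofFn_eq_map, List.sum_ofFn, Finsupp.equivFunOnFinite_symm_eq_sum]
  have hprod : ((List.finRange m).map fun h ↦ ((I h).factorial : QBar)).prod =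
      ∏ h, ((I h).factorial : QBar) := by
    rw [← List.ofFn_eq_map, List.prod_ofFn]
  rw [dividedDeriv, List.ofFn_eq_map, list_prod_pderiv I _ (List.nodup_finRange m), hsum, hprod,
    smul_smul, inv_mul_cancel₀, one_smul]
  exact Finset.prod_ne_zero_iff.mpr fun h _ ↦ by exact_mod_cast (I h).factorial_ne_zero

end DividedDeriv

end RothLemma

namespace RothLemma

open MvPolynomial Finset

/-! ### Generalized Wronskians. -/

section Wronskian

variable {σ : Type*} [Fintype σ] {K : Type*} [Field K] [CharZero K] {n : ℕ}
  {φ : Fin n → MvPolynomial σ K}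

/-- If every vector of polynomials annihilating the divided derivatives of `φ` of order less than
`a` also annihilates those of order `a`, then it annihilates all divided derivatives. -/
lemma annihilates_all {a : ℕ}
    (hstab : ∀ μ : Fin n → MvPolynomial σ K,
      (∀ J : σ →₀ ℕ, J.degree < a → ∑ j, μ j * hasse J (φ j) = 0) →
      ∀ J : σ →₀ ℕ, J.degree < a + 1 → ∑ j, μ j * hasse J (φ j) = 0)
    (d : ℕ) : ∀ μ : Fin n → MvPolynomial σ K,
      (∀ J : σ →₀ ℕ, J.degree < a → ∑ j, μ j * hasse J (φ j) = 0) →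
      ∀ J : σ →₀ ℕ, J.degree < a + 1 + d → ∑ j, μ j * hasse J (φ j) = 0 := by
  induction d with
  | zero => exact hstab
  | succ d ih =>
    intro μ hμ J hJ
    have hμd := ih μ hμ
    have hder (h : σ) (J : σ →₀ ℕ) (hJ : J.degree < a + 1 + d) :
        ∑ j, pderiv h (μ j) * hasse J (φ j) + ∑ j, μ j * pderiv h (hasse J (φ j)) = 0 := by
      have := congrArg (pderiv h) (hμd J hJ)
      rw [map_sum, map_zero] at this
      simpa only [pderiv_mul, Finset.sum_add_distrib] using this
    induction J using multiIndex_induction with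
    | zero => exact hμd 0 (by simp)
    | step J h _ =>
      have hJ' : J.degree < a + 1 + d := by
        simp only [map_add, Finsupp.degree_single] at hJ
        omega
      -- The derivative of `μ` again annihilates all orders below `a`: differentiate those relations
      -- and use that `μ` also annihilates order `a`. The induction hypothesis then applies to it.
      have h1 : ∑ j, pderiv h (μ j) * hasse J (φ j) = 0 := by
        refine ih (fun j ↦ pderiv h (μ j)) (fun J hJ ↦ ?_) J hJ'
        have h2 := hμd (J + Finsupp.single h 1)
          (by simp only [map_add, Finsupp.degree_single]; omega)
        have h3 := hder h J (by omega)
        simp only [pderiv_hasse, mul_smul_comm, ← Finset.smul_sum] at h3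
        rwa [h2, smul_zero, add_zero] at h3
      have h4 := hder h J hJ'
      rw [h1, zero_add] at h4
      simp only [hasse_add_single, mul_smul_comm, ← Finset.smul_sum, h4, smul_zero]

/-- At a point `x` the relations say that all Taylor coefficients at `x` of the constant combination
`∑ μ_j(x) φ_j` vanish, so independence over `K` forces `μ(x) = 0`. -/
lemma eq_zero_of_annihilates (hφ : LinearIndependent K φ) (μ : Fin n → MvPolynomial σ K)
    (hμ : ∀ J : σ →₀ ℕ, ∑ j, μ j * hasse J (φ j) = 0) : μ = 0 := by
  by_contra hne
  obtain ⟨j₀, hj₀⟩ := Function.ne_iff.mp hne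
  obtain ⟨x, hx⟩ : ∃ x, eval x (μ j₀) ≠ 0 := by
    by_contra! h
    exact hj₀ (MvPolynomial.funext fun x ↦ by simpa using h x)
  have hg : ∑ j, eval x (μ j) • φ j = 0 := by
    apply translate_injective x
    ext J
    have := congrArg (eval x) (hμ J)
    rw [coeff_translate]
    simpa [smul_eval] using this
  exact hx (Fintype.linearIndependent_iff.mp hφ _ hg j₀)

/-- **Generalized Wronskians**: linearly independent polynomials have a nonvanishing generalized
Wronskian, whose `i`-th row involves derivatives of order at most `i`. -/
theorem exists_det_hasse_ne_zero (hφ : LinearIndependent K φ) :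
    ∃ I : Fin n → σ →₀ ℕ, (∀ i, (I i).degree ≤ i) ∧
      (Matrix.of fun i j ↦ hasse (I i) (φ j)).det ≠ 0 := by
  let F := FractionRing (MvPolynomial σ K)
  let vec (J : σ →₀ ℕ) : Fin n → F := fun j ↦ algebraMap _ F (hasse J (φ j))
  have hinj : Function.Injective (algebraMap (MvPolynomial σ K) F) :=
    IsFractionRing.injective _ _
  -- A new row of order at most `a` always exists: otherwise all derivatives of order at most `a`
  -- lie in the span of the first `a` rows, a proper subspace, and a functional killing it
  -- annihilates everything.
  have greedy : ∀ a ≤ n, ∃ I : Fin a → σ →₀ ℕ, (∀ i, (I i).degree ≤ i) ∧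
      LinearIndependent F fun i ↦ vec (I i) := by
    intro a
    induction a with
    | zero => exact fun _ ↦ ⟨Fin.elim0, fun i ↦ i.elim0, linearIndependent_empty_type⟩
    | succ a ih =>
      intro ha
      obtain ⟨I, hI, hlin⟩ := ih (by omega)
      obtain ⟨J, hJ, hJS⟩ : ∃ J : σ →₀ ℕ, J.degree ≤ a ∧
          vec J ∉ Submodule.span F (Set.range fun i ↦ vec (I i)) := by
        by_contra! hall
        have hlt : Submodule.span F (Set.range fun i ↦ vec (I i)) < ⊤ := by
          refine lt_top_iff_ne_top.mpr fun htop ↦ ?_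
          have h1 := finrank_span_eq_card hlin
          rw [htop, finrank_top, Module.finrank_fin_fun, Fintype.card_fin] at h1
          omega
        obtain ⟨l, hl0, hl⟩ := Submodule.exists_le_ker_of_lt_top _ hlt
        have hlv (v : Fin n → F) : l v = ∑ j, l (Pi.single j 1) * v j := by
          conv_lhs => rw [← Finset.univ_sum_single v, map_sum]
          refine Finset.sum_congr rfl fun j _ ↦ ?_
          rw [mul_comm, ← smul_eq_mul, ← map_smul, ← Pi.single_smul, smul_eq_mul, mul_one]
        -- The chosen rows have order below `a` while their span contains all orders up to `a`.
        have hstab (μ : Fin n → MvPolynomial σ K)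
            (hμ : ∀ J : σ →₀ ℕ, J.degree < a → ∑ j, μ j * hasse J (φ j) = 0)
            (J : σ →₀ ℕ) (hJ : J.degree < a + 1) : ∑ j, μ j * hasse J (φ j) = 0 := by
          let L : (Fin n → F) →ₗ[F] F :=
            Fintype.linearCombination F (fun j ↦ algebraMap _ F (μ j))
          have hL (J : σ →₀ ℕ) : L (vec J) = algebraMap _ F (∑ j, μ j * hasse J (φ j)) := by
            simp [L, vec, Fintype.linearCombination_apply, mul_comm]
          have hle : Submodule.span F (Set.range fun i ↦ vec (I i)) ≤ LinearMap.ker L := by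
            rw [Submodule.span_le]
            rintro _ ⟨i, rfl⟩
            have := hμ (I i) ((hI i).trans_lt i.2)
            simp [hL, this]
          have := hle (hall J (by omega))
          rw [LinearMap.mem_ker, hL] at this
          exact hinj (by rw [this, map_zero])
        obtain ⟨b, hb⟩ := IsLocalization.exist_integer_multiples_of_finite
          (nonZeroDivisors (MvPolynomial σ K)) fun j ↦ l (Pi.single j 1)
        choose μ hμ using hb
        have hμ' (j : Fin n) : algebraMap _ F (μ j) =
            algebraMap _ F (b : MvPolynomial σ K) * l (Pi.single j 1) := by
          rw [← Algebra.smul_def]; exact hμ j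
        have hb0 : algebraMap _ F (b : MvPolynomial σ K) ≠ 0 :=
          fun h ↦ nonZeroDivisors.coe_ne_zero b (hinj (by rw [h, map_zero]))
        have hμann (J : σ →₀ ℕ) (hJ : J.degree < a) : ∑ j, μ j * hasse J (φ j) = 0 := by
          apply hinj
          have h1 := hl (hall J hJ.le)
          rw [LinearMap.mem_ker, hlv] at h1
          simp only [map_sum, map_mul, map_zero, hμ', mul_assoc, ← Finset.mul_sum]
          rw [show ∑ j, l (Pi.single j 1) * algebraMap _ F (hasse J (φ j)) = 0 from h1, mul_zero]
        have hμ0 : μ = 0 := eq_zero_of_annihilates hφ μ fun J ↦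
          annihilates_all hstab J.degree μ hμann J (by omega)
        apply hl0
        have hl1 (j : Fin n) : l (Pi.single j 1) = 0 := by
          have := hμ' j
          rw [hμ0] at this
          simpa [hb0] using this
        refine LinearMap.ext fun v ↦ ?_
        rw [hlv]
        simp [hl1]
      refine ⟨Fin.snoc I J, fun i ↦ ?_, ?_⟩
      · refine Fin.lastCases ?_ (fun i ↦ ?_) i
        · simpa using hJ
        · simpa using hI i
      · have : (fun i ↦ vec ((Fin.snoc I J : Fin (a + 1) → σ →₀ ℕ) i)) =
            Fin.snoc (fun i ↦ vec (I i)) (vec J) := by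
          ext1 i
          refine Fin.lastCases ?_ (fun i ↦ ?_) i <;> simp
        rw [this]
        exact linearIndependent_finSnoc.mpr ⟨hlin, hJS⟩
  obtain ⟨I, hI, hlin⟩ := greedy n le_rfl
  refine ⟨I, hI, fun h0 ↦ ?_⟩
  have h1 : LinearIndependent F
      (Matrix.of fun i j ↦ algebraMap _ F (hasse (I i) (φ j))).row := hlin
  rw [Matrix.linearIndependent_rows_iff_isUnit, Matrix.isUnit_iff_isUnit_det] at h1
  have h2 := congrArg (algebraMap _ F) h0
  rw [RingHom.map_det, map_zero] at h2
  exact h1.ne_zero h2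

end Wronskian

end RothLemma

namespace RothLemma

open MvPolynomial Finset

/-! ### Products in disjoint sets of variables. -/

section SumVariables

variable {σ τ : Type*} {K : Type*} [Field K]

/-- The product of two polynomials in disjoint sets of variables. -/
noncomputable def tmul : MvPolynomial σ K →ₗ[K] MvPolynomial τ K →ₗ[K] MvPolynomial (σ ⊕ τ) K :=
  (LinearMap.mul K (MvPolynomial (σ ⊕ τ) K)).compl₁₂ (rename Sum.inl).toLinearMap
    (rename Sum.inr).toLinearMap

lemma tmul_apply (f : MvPolynomial σ K) (g : MvPolynomial τ K) :
    tmul f g = rename Sum.inl f * rename Sum.inr g := rfl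

lemma tmul_monomial (I : σ →₀ ℕ) (J : τ →₀ ℕ) (a b : K) :
    tmul (monomial I a) (monomial J b) = monomial (I.sumElim J) (a * b) := by
  rw [tmul_apply, rename_monomial, rename_monomial, monomial_mul, Finsupp.sumElim_eq_add]

lemma exists_eq_sumElim (S : σ ⊕ τ →₀ ℕ) : ∃ I J, S = Finsupp.sumElim I J :=
  ⟨_, _, (Finsupp.comapDomain_sumElim_comapDomain S).symm⟩

lemma sumElim_inj {I I' : σ →₀ ℕ} {J J' : τ →₀ ℕ} :
    I.sumElim J = I'.sumElim J' ↔ I = I' ∧ J = J' := by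
  refine ⟨fun h ↦ ⟨?_, ?_⟩, fun h ↦ by rw [h.1, h.2]⟩
  · ext x; exact DFunLike.congr_fun h (Sum.inl x)
  · ext x; exact DFunLike.congr_fun h (Sum.inr x)

lemma coeff_tmul (f : MvPolynomial σ K) (g : MvPolynomial τ K) (I : σ →₀ ℕ) (J : τ →₀ ℕ) :
    coeff (I.sumElim J) (tmul f g) = coeff I f * coeff J g := by
  classical
  induction f using MvPolynomial.induction_on' with
  | add p q hp hq => rw [map_add, LinearMap.add_apply, coeff_add, hp, hq, coeff_add, add_mul]
  | monomial S c =>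
    induction g using MvPolynomial.induction_on' with
    | add p q hp hq => rw [map_add, coeff_add, hp, hq, coeff_add, mul_add]
    | monomial T d =>
      rw [tmul_monomial, coeff_monomial, coeff_monomial, coeff_monomial]
      by_cases h1 : S = I <;> by_cases h2 : T = J <;> simp [sumElim_inj, h1, h2]

lemma translate_tmul (β : σ ⊕ τ → K) (f : MvPolynomial σ K) (g : MvPolynomial τ K) :
    translate β (tmul f g) = tmul (translate (β ∘ Sum.inl) f) (translate (β ∘ Sum.inr) g) := by
  have h1 : (translate β).comp (rename Sum.inl) =
      (rename Sum.inl).comp (translate (β ∘ Sum.inl)) := by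
    ext x; simp [translate]
  have h2 : (translate β).comp (rename Sum.inr) =
      (rename Sum.inr).comp (translate (β ∘ Sum.inr)) := by
    ext x; simp [translate]
  rw [tmul_apply, map_mul, tmul_apply]
  congr 1
  · exact DFunLike.congr_fun h1 f
  · exact DFunLike.congr_fun h2 g

lemma hasse_tmul [Fintype σ] [Fintype τ] (I : σ →₀ ℕ) (J : τ →₀ ℕ) (f : MvPolynomial σ K)
    (g : MvPolynomial τ K) :
    hasse (I.sumElim J) (tmul f g) = tmul (hasse I f) (hasse J g) := by
  ext S
  obtain ⟨A, B, rfl⟩ := exists_eq_sumElim S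
  rw [coeff_tmul, coeff_hasse, coeff_hasse, coeff_hasse, ← Finsupp.sumElim_add, coeff_tmul,
    Fintype.prod_sum_type]
  simp only [Finsupp.sumElim_inl, Finsupp.sumElim_inr]
  ring

lemma wt_sumElim [Fintype σ] [Fintype τ] (w : σ ⊕ τ → ℝ) (I : σ →₀ ℕ) (J : τ →₀ ℕ) :
    wt w (I.sumElim J) = wt (w ∘ Sum.inl) I + wt (w ∘ Sum.inr) J := by
  simp [wt, Fintype.sum_sum_type]

end SumVariables

/-! ### Shortest decompositions into products. -/

section Decomposition

variable {K A C D : Type*} [Field K] [AddCommGroup A] [AddCommGroup C] [AddCommGroup D]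
  [Module K A] [Module K C] [Module K D]

/-- A relation expresses one `ψ` through the others; its term is absorbed by modifying the remaining
`φ`. -/
lemma exists_shorter_sum (B : A →ₗ[K] C →ₗ[K] D) {n : ℕ} (φ : Fin (n + 1) → A)
    (ψ : Fin (n + 1) → C) (h : ¬ LinearIndependent K ψ) :
    ∃ (φ' : Fin n → A) (ψ' : Fin n → C), ∑ j, B (φ' j) (ψ' j) = ∑ j, B (φ j) (ψ j) := by
  rw [Fintype.not_linearIndependent_iff] at h
  obtain ⟨c, hc, i, hi⟩ := h
  refine ⟨fun j ↦ φ (i.succAbove j) - ((c i)⁻¹ * c (i.succAbove j)) • φ i,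
    fun j ↦ ψ (i.succAbove j), ?_⟩
  have hψ : ψ i = - ∑ j, ((c i)⁻¹ * c (i.succAbove j)) • ψ (i.succAbove j) := by
    rw [Fin.sum_univ_succAbove _ i] at hc
    have := congrArg (fun x ↦ (c i)⁻¹ • x) hc
    simp only [smul_add, smul_smul, inv_mul_cancel₀ hi, one_smul, smul_zero, Finset.smul_sum]
      at this
    exact eq_neg_of_add_eq_zero_left this
  rw [Fin.sum_univ_succAbove (fun j ↦ B (φ j) (ψ j)) i, hψ]
  simp only [map_sub, map_smul, LinearMap.sub_apply, LinearMap.smul_apply, map_neg, map_sum,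
    Finset.sum_sub_distrib]
  abel

/-- In a representation with the fewest terms, dependence on either side would allow a shorter one
by `exists_shorter_sum`, applied to `B` or `B.flip`. -/
lemma exists_linearIndependent_sum (B : A →ₗ[K] C →ₗ[K] D) {n₀ : ℕ} (φ₀ : Fin n₀ → A)
    (ψ₀ : Fin n₀ → C) : ∃ n ≤ n₀, ∃ (φ : Fin n → A) (ψ : Fin n → C),
      LinearIndependent K φ ∧ LinearIndependent K ψ ∧
        ∑ j, B (φ j) (ψ j) = ∑ j, B (φ₀ j) (ψ₀ j) := by
  classical
  have hex : ∃ n, ∃ (φ : Fin n → A) (ψ : Fin n → C),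
      ∑ j, B (φ j) (ψ j) = ∑ j, B (φ₀ j) (ψ₀ j) := ⟨n₀, φ₀, ψ₀, rfl⟩
  obtain ⟨φ, ψ, h⟩ := Nat.find_spec hex
  have hmin := fun k ↦ Nat.find_min (m := k) hex
  have hle := Nat.find_min' hex ⟨φ₀, ψ₀, rfl⟩
  generalize Nat.find hex = n at φ ψ hmin hle
  refine ⟨n, hle, φ, ψ, ?_, ?_, h⟩
  · cases n with
    | zero => exact linearIndependent_empty_type
    | succ n =>
      by_contra hcon
      obtain ⟨ψ', φ', h'⟩ := exists_shorter_sum B.flip ψ φ hcon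
      exact hmin n (Nat.lt_succ_self n) ⟨φ', ψ', h'.trans h⟩
  · cases n with
    | zero => exact linearIndependent_empty_type
    | succ n =>
      by_contra hcon
      obtain ⟨φ', ψ', h'⟩ := exists_shorter_sum B φ ψ hcon
      exact hmin n (Nat.lt_succ_self n) ⟨φ', ψ', h'.trans h⟩

lemma exists_sum_tmul {σ : Type*} (P : MvPolynomial (σ ⊕ Fin 1) K) {ρ : ℕ}
    (hρ : P.degreeOf (Sum.inr 0) ≤ ρ) :
    ∃ (φ : Fin (ρ + 1) → MvPolynomial σ K) (ψ : Fin (ρ + 1) → MvPolynomial (Fin 1) K),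
      ∑ j, tmul (φ j) (ψ j) = P := by
  classical
  -- `Fin.ofNat` reduces modulo `ρ + 1`, which changes no exponent occurring in `P`.
  let g (S : σ ⊕ Fin 1 →₀ ℕ) : Fin (ρ + 1) := Fin.ofNat (ρ + 1) (S (Sum.inr 0))
  refine ⟨fun b ↦ ∑ S ∈ P.support with g S = b,
      monomial (S.comapDomain Sum.inl Sum.inl_injective.injOn) (coeff S P),
    fun b ↦ monomial (Finsupp.single 0 (b : ℕ)) 1, ?_⟩
  simp only [map_sum, LinearMap.sum_apply, tmul_monomial, mul_one]
  rw [Finset.sum_congr rfl (g := fun b ↦ ∑ S ∈ P.support with g S = b, monomial S (coeff S P)),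
    Finset.sum_fiberwise, ← MvPolynomial.as_sum]
  refine fun b _ ↦ Finset.sum_congr rfl fun S hS ↦ ?_
  obtain ⟨hSP, rfl⟩ := Finset.mem_filter.mp hS
  have hle : S (Sum.inr 0) ≤ ρ := degreeOf_le_iff.mp hρ S hSP
  have hS' : (S.comapDomain Sum.inl Sum.inl_injective.injOn).sumElim
      (Finsupp.single 0 (g S : ℕ)) = S := by
    ext x
    rcases x with x | x
    · simp
    · have : x = 0 := Subsingleton.elim _ _
      subst this
      simp [g, Nat.mod_eq_of_lt (Nat.lt_succ_of_le hle)]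
  rw [hS']

end Decomposition

end RothLemma

namespace RothLemma

open MvPolynomial Finset

/-! ### Maximum and length of the coefficients. -/

section Norms

variable {σ : Type*} {K : Type*} [Field K] (v : AbsoluteValue K ℝ)

/-- The maximum of the absolute values of the coefficients. -/
noncomputable def gaussNorm (P : MvPolynomial σ K) : ℝ := ⨆ s : P.support, v (coeff s P)

/-- The sum of the absolute values of the coefficients. -/
noncomputable def lengthNorm (P : MvPolynomial σ K) : ℝ := ∑ s ∈ P.support, v (coeff s P)

lemma gaussNorm_nonneg (P : MvPolynomial σ K) : 0 ≤ gaussNorm v P :=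
  Real.iSup_nonneg fun _ ↦ v.nonneg _

lemma lengthNorm_nonneg (P : MvPolynomial σ K) : 0 ≤ lengthNorm v P :=
  Finset.sum_nonneg fun _ _ ↦ v.nonneg _

lemma apply_coeff_le_gaussNorm (P : MvPolynomial σ K) (I : σ →₀ ℕ) :
    v (coeff I P) ≤ gaussNorm v P := by
  by_cases hI : I ∈ P.support
  · exact Finite.le_ciSup_of_le (f := fun s : P.support ↦ v (coeff s P)) ⟨I, hI⟩ le_rfl
  · rw [notMem_support_iff.mp hI, map_zero]
    exact gaussNorm_nonneg v P

variable {v} in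
lemma gaussNorm_le {P : MvPolynomial σ K} {B : ℝ} (hB : 0 ≤ B) (h : ∀ I, v (coeff I P) ≤ B) :
    gaussNorm v P ≤ B :=
  Real.iSup_le (fun s ↦ h s) hB

lemma lengthNorm_eq_sum {P : MvPolynomial σ K} {S : Finset (σ →₀ ℕ)} (hS : P.support ⊆ S) :
    lengthNorm v P = ∑ s ∈ S, v (coeff s P) :=
  Finset.sum_subset hS fun s _ hs ↦ by rw [notMem_support_iff.mp hs, map_zero]

lemma gaussNorm_le_lengthNorm (P : MvPolynomial σ K) : gaussNorm v P ≤ lengthNorm v P := by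
  refine gaussNorm_le (lengthNorm_nonneg v P) fun I ↦ ?_
  by_cases hI : I ∈ P.support
  · exact Finset.single_le_sum (f := fun s ↦ v (coeff s P)) (fun s _ ↦ v.nonneg _) hI
  · rw [notMem_support_iff.mp hI, map_zero]
    exact lengthNorm_nonneg v P

lemma lengthNorm_add_le (P Q : MvPolynomial σ K) :
    lengthNorm v (P + Q) ≤ lengthNorm v P + lengthNorm v Q := by
  classical
  rw [lengthNorm_eq_sum v (support_add (p := P) (q := Q)),
    lengthNorm_eq_sum v (Finset.subset_union_left (s₁ := P.support) (s₂ := Q.support)),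
    lengthNorm_eq_sum v (Finset.subset_union_right (s₁ := P.support) (s₂ := Q.support)),
    ← Finset.sum_add_distrib]
  exact Finset.sum_le_sum fun s _ ↦ by rw [coeff_add]; exact v.add_le _ _

lemma lengthNorm_sum_le {ι : Type*} (s : Finset ι) (f : ι → MvPolynomial σ K) :
    lengthNorm v (∑ i ∈ s, f i) ≤ ∑ i ∈ s, lengthNorm v (f i) :=
  Finset.le_sum_of_subadditive _ (by simp [lengthNorm]) (lengthNorm_add_le v) s f

lemma lengthNorm_monomial_le (I : σ →₀ ℕ) (c : K) : lengthNorm v (monomial I c) ≤ v c := by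
  classical
  rw [lengthNorm_eq_sum v (support_monomial_subset (s := I) (a := c))]
  simp

lemma lengthNorm_mul_le (P Q : MvPolynomial σ K) :
    lengthNorm v (P * Q) ≤ lengthNorm v P * lengthNorm v Q := by
  conv_lhs => rw [P.as_sum, Q.as_sum, Finset.sum_mul_sum]
  refine (lengthNorm_sum_le v _ _).trans ?_
  rw [lengthNorm, lengthNorm, Finset.sum_mul_sum]
  refine Finset.sum_le_sum fun s _ ↦ (lengthNorm_sum_le v _ _).trans ?_
  refine Finset.sum_le_sum fun t _ ↦ ?_
  rw [monomial_mul, ← map_mul]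
  exact lengthNorm_monomial_le v _ _

lemma lengthNorm_prod_le {ι : Type*} (s : Finset ι) (f : ι → MvPolynomial σ K) :
    lengthNorm v (∏ i ∈ s, f i) ≤ ∏ i ∈ s, lengthNorm v (f i) := by
  classical
  induction s using Finset.induction_on with
  | empty =>
    simpa using lengthNorm_monomial_le v (0 : σ →₀ ℕ) (1 : K)
  | insert i s hi ih =>
    rw [Finset.prod_insert hi, Finset.prod_insert hi]
    exact (lengthNorm_mul_le v _ _).trans
      (mul_le_mul_of_nonneg_left ih (lengthNorm_nonneg v _))

lemma coeff_sign_mul {n : ℕ} (π : Equiv.Perm (Fin n)) (f : MvPolynomial σ K) (I : σ →₀ ℕ) :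
    v (coeff I (((Equiv.Perm.sign π : ℤ) : MvPolynomial σ K) * f)) = v (coeff I f) := by
  rcases Int.units_eq_one_or (Equiv.Perm.sign π) with h | h <;> simp [h]

lemma lengthNorm_sign_mul {n : ℕ} (π : Equiv.Perm (Fin n)) (f : MvPolynomial σ K) :
    lengthNorm v (((Equiv.Perm.sign π : ℤ) : MvPolynomial σ K) * f) = lengthNorm v f := by
  rcases Int.units_eq_one_or (Equiv.Perm.sign π) with h | h <;> simp [h, lengthNorm]

lemma lengthNorm_det_le {n : ℕ} (M : Matrix (Fin n) (Fin n) (MvPolynomial σ K)) {B : ℝ}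
    (hM : ∀ a b, lengthNorm v (M a b) ≤ B) :
    lengthNorm v M.det ≤ n.factorial * B ^ n := by
  rw [Matrix.det_apply']
  refine (lengthNorm_sum_le v _ _).trans ?_
  calc ∑ π : Equiv.Perm (Fin n), lengthNorm v (((Equiv.Perm.sign π : ℤ) : MvPolynomial σ K) *
        ∏ i, M (π i) i) ≤ ∑ _π : Equiv.Perm (Fin n), B ^ n := by
        refine Finset.sum_le_sum fun π _ ↦ ?_
        rw [lengthNorm_sign_mul]
        refine (lengthNorm_prod_le v _ _).trans ?_
        refine (Finset.prod_le_prod (fun i _ ↦ lengthNorm_nonneg v _) fun i _ ↦ hM _ _).trans ?_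
        simp
    _ = n.factorial * B ^ n := by simp [Fintype.card_perm]

variable {v}

lemma apply_sum_le_of_isNonarchimedean (hv : IsNonarchimedean v) {ι : Type*} (s : Finset ι)
    (f : ι → K) {B : ℝ} (hB : 0 ≤ B) (hf : ∀ i ∈ s, v (f i) ≤ B) : v (∑ i ∈ s, f i) ≤ B := by
  classical
  induction s using Finset.induction_on with
  | empty => simpa using hB
  | insert i s hi ih =>
    rw [Finset.sum_insert hi]
    exact (hv _ _).trans (max_le (hf i (mem_insert_self i s))
      (ih fun j hj ↦ hf j (mem_insert_of_mem hj)))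

lemma gaussNorm_mul_le (hv : IsNonarchimedean v) (P Q : MvPolynomial σ K) :
    gaussNorm v (P * Q) ≤ gaussNorm v P * gaussNorm v Q := by
  classical
  have h0 := mul_nonneg (gaussNorm_nonneg v P) (gaussNorm_nonneg v Q)
  refine gaussNorm_le h0 fun I ↦ ?_
  rw [coeff_mul]
  refine apply_sum_le_of_isNonarchimedean hv _ _ h0 fun x _ ↦ ?_
  rw [map_mul]
  exact mul_le_mul (apply_coeff_le_gaussNorm v P _) (apply_coeff_le_gaussNorm v Q _)
    (v.nonneg _) (gaussNorm_nonneg v P)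

lemma gaussNorm_prod_le (hv : IsNonarchimedean v) {ι : Type*} (s : Finset ι)
    (f : ι → MvPolynomial σ K) :
    gaussNorm v (∏ i ∈ s, f i) ≤ ∏ i ∈ s, gaussNorm v (f i) := by
  classical
  induction s using Finset.induction_on with
  | empty =>
    refine gaussNorm_le (by simp) fun I ↦ ?_
    rw [Finset.prod_empty, coeff_one]
    split_ifs <;> simp
  | insert i s hi ih =>
    rw [Finset.prod_insert hi, Finset.prod_insert hi]
    exact (gaussNorm_mul_le hv _ _).trans
      (mul_le_mul_of_nonneg_left ih (gaussNorm_nonneg v _))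

lemma gaussNorm_det_le (hv : IsNonarchimedean v) {n : ℕ}
    (M : Matrix (Fin n) (Fin n) (MvPolynomial σ K)) {B : ℝ} (hB : 0 ≤ B)
    (hM : ∀ a b, gaussNorm v (M a b) ≤ B) : gaussNorm v M.det ≤ B ^ n := by
  have h0 : 0 ≤ B ^ n := pow_nonneg hB n
  refine gaussNorm_le h0 fun I ↦ ?_
  rw [Matrix.det_apply', coeff_sum]
  refine apply_sum_le_of_isNonarchimedean hv _ _ h0 fun π _ ↦ ?_
  rw [coeff_sign_mul]
  refine (apply_coeff_le_gaussNorm v _ I).trans ((gaussNorm_prod_le hv _ _).trans ?_)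
  refine (Finset.prod_le_prod (fun i _ ↦ gaussNorm_nonneg v _) fun i _ ↦ hM _ _).trans ?_
  simp

end Norms

/-! ### Norms of divided derivatives. -/

section HasseNorm

variable {σ : Type*} [Fintype σ] {K : Type*} [Field K] {v : AbsoluteValue K ℝ}

lemma choose_succ_le_two_pow (r i : ℕ) : (r + 1).choose i ≤ 2 ^ r := by
  induction r generalizing i with
  | zero =>
    rcases i with _ | _ | i <;> simp [Nat.choose_eq_zero_of_lt]
  | succ r ih =>
    rcases i with _ | i
    · simpa using Nat.one_le_two_pow
    · have h1 := ih i
      have h2 := ih (i + 1)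
      rw [Nat.choose_succ_succ', pow_succ]
      omega

/-- Counting monomials and bounding binomials together gives `2 ^ r`, with no extra factor `r + 1`.
-/
lemma sum_choose_le_two_pow (r i : ℕ) : ∑ s ∈ range (r + 1), s.choose i ≤ 2 ^ r := by
  induction r with
  | zero => simpa using Nat.choose_le_two_pow 0 i
  | succ r ih =>
    rw [Finset.sum_range_succ, pow_succ]
    have := choose_succ_le_two_pow r i
    omega

lemma gaussNorm_hasse_le (hv : IsNonarchimedean v) (I : σ →₀ ℕ) (P : MvPolynomial σ K) :
    gaussNorm v (hasse I P) ≤ gaussNorm v P := by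
  refine gaussNorm_le (gaussNorm_nonneg v P) fun J ↦ ?_
  rw [coeff_hasse, map_mul, ← Nat.cast_prod]
  exact (mul_le_of_le_one_left (v.nonneg _) (hv.apply_natCast_le_one)).trans
    (apply_coeff_le_gaussNorm v P _)

lemma lengthNorm_hasse_le (v : AbsoluteValue K ℝ) (I : σ →₀ ℕ) (P : MvPolynomial σ K) {r : σ → ℕ}
    (hr : ∀ h, P.degreeOf h ≤ r h) :
    lengthNorm v (hasse I P) ≤ 2 ^ (∑ h, r h) * gaussNorm v P := by
  classical
  have hstep : lengthNorm v (hasse I P) ≤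
      (∑ J ∈ (hasse I P).support, ∏ h, ((J h + I h).choose (I h) : ℝ)) * gaussNorm v P := by
    rw [lengthNorm, Finset.sum_mul]
    refine Finset.sum_le_sum fun J _ ↦ ?_
    rw [coeff_hasse, map_mul, ← Nat.cast_prod, ← Nat.cast_prod]
    exact mul_le_mul (v.apply_nat_le_self _) (apply_coeff_le_gaussNorm v P _) (v.nonneg _)
      (Nat.cast_nonneg _)
  refine hstep.trans (mul_le_mul_of_nonneg_right ?_ (gaussNorm_nonneg v P))
  have hnat : ∑ J ∈ (hasse I P).support, ∏ h, (J h + I h).choose (I h) ≤ 2 ^ (∑ h, r h) := by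
    calc ∑ J ∈ (hasse I P).support, ∏ h, (J h + I h).choose (I h)
        = ∑ S ∈ (hasse I P).support.image (fun J h ↦ J h + I h), ∏ h, (S h).choose (I h) := by
          rw [Finset.sum_image]
          intro J _ J' _ h
          ext x
          have := congrFun h x
          simpa using this
      _ ≤ ∑ S ∈ Fintype.piFinset fun h ↦ range (r h + 1), ∏ h, (S h).choose (I h) := by
          refine Finset.sum_le_sum_of_subset fun S hS ↦ ?_
          obtain ⟨J, hJ, rfl⟩ := Finset.mem_image.mp hS
          rw [mem_support_iff, coeff_hasse] at hJ
          refine Fintype.mem_piFinset.mpr fun h ↦ mem_range.mpr (Nat.lt_succ_of_le ?_)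
          exact (degreeOf_le_iff.mp (hr h) (J + I) (mem_support_iff.mpr (right_ne_zero_of_mul hJ)))
      _ = ∏ h, ∑ s ∈ range (r h + 1), s.choose (I h) :=
          (Finset.prod_univ_sum (fun h ↦ range (r h + 1)) fun h s ↦ s.choose (I h)).symm
      _ ≤ ∏ h, 2 ^ r h :=
          Finset.prod_le_prod (fun _ _ ↦ Nat.zero_le _) fun h _ ↦ sum_choose_le_two_pow (r h) (I h)
      _ = 2 ^ (∑ h, r h) := Finset.prod_pow_eq_pow_sum _ _ _
  exact_mod_cast hnat

end HasseNorm

lemma coeffFun_ne_zero {σ K : Type*} [Field K] {P : MvPolynomial σ K} (hP : P ≠ 0) :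
    (fun s : P.support ↦ coeff s P) ≠ 0 := by
  obtain ⟨s, hs⟩ := support_nonempty.mpr hP
  exact Function.ne_iff.mpr ⟨⟨s, hs⟩, mem_support_iff.mp hs⟩

/-! ### Heights of polynomials and determinants. -/

section PolyHt

open Height AdmissibleAbsValues

variable {σ τ : Type*} {K : Type*} [Field K] [AdmissibleAbsValues K]

/-- The logarithmic height of the coefficients of a polynomial. -/
noncomputable def coeffHeight (P : MvPolynomial σ K) : ℝ :=
  logHeight fun s : P.support ↦ coeff s P

lemma coeffHeight_nonneg (P : MvPolynomial σ K) : 0 ≤ coeffHeight P := logHeight_nonneg _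

/-- The height of a product of polynomials in disjoint sets of variables. -/
lemma coeffHeight_add_le_tmul {f : MvPolynomial σ K} {g : MvPolynomial τ K} (hf : f ≠ 0)
    (hg : g ≠ 0) : coeffHeight f + coeffHeight g ≤ coeffHeight (tmul f g) := by
  rw [coeffHeight, coeffHeight, ← logHeight_fun_mul_eq (coeffFun_ne_zero hf) (coeffFun_ne_zero hg)]
  have hmem (a : f.support × g.support) :
      Finsupp.sumElim (a.1 : σ →₀ ℕ) (a.2 : τ →₀ ℕ) ∈ (tmul f g).support := by
    rw [mem_support_iff, coeff_tmul]
    exact mul_ne_zero (mem_support_iff.mp a.1.2) (mem_support_iff.mp a.2.2)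
  refine le_trans (le_of_eq ?_) (logHeight_comp_le
    (fun a : f.support × g.support ↦ (⟨_, hmem a⟩ : (tmul f g).support))
    fun s : (tmul f g).support ↦ coeff s (tmul f g))
  congr 1
  ext a
  exact (coeff_tmul f g a.1 a.2).symm

/-- All entries are derivatives of one polynomial, whose coefficients therefore control the
determinant. The length is submultiplicative and serves the archimedean places; the other places
contribute no constant. -/
lemma coeffHeight_det_hasse_le [Fintype σ] {P : MvPolynomial σ K} {r : σ → ℕ}
    (hr : ∀ h, P.degreeOf h ≤ r h) {n : ℕ} (I : Fin n → Fin n → σ →₀ ℕ)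
    (hP : P ≠ 0) (hW : (Matrix.of fun a b ↦ hasse (I a b) P).det ≠ 0) :
    coeffHeight (Matrix.of fun a b ↦ hasse (I a b) P).det ≤ n * coeffHeight P +
      totalWeight K * Real.log (n.factorial * (2 ^ (∑ h, r h)) ^ n) := by
  refine logHeight_le_of_local (coeffFun_ne_zero hP) (coeffFun_ne_zero hW) (by positivity) n
    (fun v _ ↦ ?_) fun v hv ↦ ?_
  · refine (gaussNorm_le_lengthNorm v _).trans ?_
    refine (lengthNorm_det_le v _ fun a b ↦ lengthNorm_hasse_le v (I a b) P hr).trans (le_of_eq ?_)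
    rw [mul_pow, ← mul_assoc]
    rfl
  · have hv' := AdmissibleAbsValues.isNonarchimedean v hv
    exact gaussNorm_det_le hv' _ (gaussNorm_nonneg v P) fun a b ↦ gaussNorm_hasse_le hv' (I a b) P

end PolyHt

end RothLemma

namespace RothLemma

/-! ### Local bounds for division by a power of `X - β`. -/

section LocalDivision

open Polynomial

variable {K : Type*} [Field K] {v : AbsoluteValue K ℝ} {bd : ℕ → ℝ} {β : K} {d : ℕ}

/-- Division from the top coefficient downwards only multiplies by `β`, so it is stable for `v β ≤
1`. Here `bd s` bounds a sum of `s` coefficients, which treats archimedean and ultrametric places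
alike; Pascal's rule counts the summands. -/
lemma coeff_div_le_of_le_one (hbd : ∀ s, 0 ≤ bd s)
    (hadd : ∀ x y s t, v x ≤ bd s → v y ≤ bd t → v (x + y) ≤ bd (s + t)) (hβ : v β ≤ 1)
    {p : K[X]} (hp : p.natDegree ≤ d) (hp1 : ∀ i, v (p.coeff i) ≤ bd 1) (k : ℕ) :
    ∀ (q : K[X]), p = (X - C β) ^ k * q → ∀ j, v (q.coeff j) ≤ bd ((d - j).choose k) := by
  induction k with
  | zero => intro q hq j; simpa [hq] using hp1 j
  | succ k ih =>
    intro q hq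
    have ih' := ih ((X - C β) * q) (by rw [hq]; ring)
    have hrec (j : ℕ) : q.coeff j = ((X - C β) * q).coeff (j + 1) + β * q.coeff (j + 1) := by
      rw [sub_mul, coeff_sub, coeff_X_mul, coeff_C_mul]; ring
    have hdeg (j : ℕ) (hj : d ≤ j) : q.coeff j = 0 := by
      by_cases hq0 : q = 0
      · simp [hq0]
      have hnd : p.natDegree = (k + 1) + q.natDegree := by
        rw [hq, natDegree_mul (pow_ne_zero _ (X_sub_C_ne_zero β)) hq0, natDegree_pow,
          natDegree_X_sub_C, mul_one]
      exact coeff_eq_zero_of_natDegree_lt (by omega)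
    suffices H : ∀ e j, d - j = e → v (q.coeff j) ≤ bd (e.choose (k + 1)) from
      fun j ↦ H _ j rfl
    intro e
    induction e with
    | zero =>
      intro j hj
      rw [hdeg j (by omega), map_zero]
      exact hbd _
    | succ e ihe =>
      intro j hj
      rw [hrec, Nat.choose_succ_succ']
      refine hadd _ _ _ _ ?_ ?_
      · have := ih' (j + 1)
        rwa [show d - (j + 1) = e by omega] at this
      · rw [map_mul]
        exact (mul_le_of_le_one_left (v.nonneg _) hβ).trans (ihe (j + 1) (by omega))

/-- Division from the constant term upwards is the stable direction when `1 ≤ v β`; the factor `β ^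
k` clears the inverse powers of `β`. -/
lemma coeff_div_le_of_one_le
    (hadd : ∀ x y s t, v x ≤ bd s → v y ≤ bd t → v (x + y) ≤ bd (s + t)) (hβ : 1 ≤ v β)
    {p : K[X]} (hp1 : ∀ i, v (p.coeff i) ≤ bd 1) (k : ℕ) :
    ∀ (q : K[X]), p = (X - C β) ^ k * q →
      ∀ j, v (β ^ k * q.coeff j) ≤ bd ((k + j).choose k) := by
  induction k with
  | zero => intro q hq j; simpa [hq] using hp1 j
  | succ k ih =>
    intro q hq j
    have ih' := ih ((X - C β) * q) (by rw [hq]; ring)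
    induction j with
    | zero =>
      have : β ^ (k + 1) * q.coeff 0 = -(β ^ k * ((X - C β) * q).coeff 0) := by
        simp [mul_coeff_zero]; ring
      rw [this, v.map_neg]
      simpa using ih' 0
    | succ j ihj =>
      have : β ^ (k + 1) * q.coeff (j + 1) =
          -(β ^ k * ((X - C β) * q).coeff (j + 1)) + β ^ k * q.coeff j := by
        rw [sub_mul, coeff_sub, coeff_X_mul, coeff_C_mul]; ring
      rw [this, show k + 1 + (j + 1) = (k + (j + 1)) + 1 by ring, Nat.choose_succ_succ']
      refine hadd _ _ _ _ ?_ ?_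
      · rw [v.map_neg]
        exact ih' (j + 1)
      · rw [show k + (j + 1) = k + 1 + j by ring]
        refine le_trans ?_ ihj
        rw [pow_succ, map_mul, map_mul, map_mul]
        exact mul_le_mul_of_nonneg_right (le_mul_of_one_le_right (v.nonneg _) hβ) (v.nonneg _)

lemma coeff_div_le (hbd : ∀ s, 0 ≤ bd s) (hmono : Monotone bd)
    (hadd : ∀ x y s t, v x ≤ bd s → v y ≤ bd t → v (x + y) ≤ bd (s + t))
    {p q : K[X]} (hp : p.natDegree ≤ d) (hp1 : ∀ i, v (p.coeff i) ≤ bd 1) {k : ℕ}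
    (hq : p = (X - C β) ^ k * q) (j : ℕ) (i : Fin 2) :
    v (![β ^ k, 1] i * q.coeff j) ≤ bd (2 ^ d) := by
  by_cases hj : q.coeff j = 0
  · simpa [hj] using hbd _
  have hq0 : q ≠ 0 := by rintro rfl; simp at hj
  have hnd : p.natDegree = k + q.natDegree := by
    rw [hq, natDegree_mul (pow_ne_zero _ (X_sub_C_ne_zero β)) hq0, natDegree_pow,
      natDegree_X_sub_C, mul_one]
  have hjd := le_natDegree_of_ne_zero hj
  rcases le_total (v β) 1 with hβ | hβ
  · have h := (coeff_div_le_of_le_one hbd hadd hβ hp hp1 k q hq j).trans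
      (hmono ((Nat.choose_le_two_pow _ _).trans
        (Nat.pow_le_pow_right two_pos (Nat.sub_le d j))))
    refine le_trans ?_ h
    rw [map_mul]
    refine mul_le_of_le_one_left (v.nonneg _) ?_
    fin_cases i
    · simpa using pow_le_one₀ (v.nonneg _) hβ
    · simp
  · have h := (coeff_div_le_of_one_le hadd hβ hp1 k q hq j).trans
      (hmono ((Nat.choose_le_two_pow _ _).trans
        (Nat.pow_le_pow_right two_pos (show k + j ≤ d by omega))))
    refine le_trans ?_ h
    rw [map_mul, map_mul]
    refine mul_le_mul_of_nonneg_right ?_ (v.nonneg _)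
    fin_cases i
    · simp
    · simpa using one_le_pow₀ hβ

end LocalDivision

/-! ### Order of vanishing in one variable. -/

section Univariate

open MvPolynomial Height AdmissibleAbsValues

variable {K : Type*} [Field K]

/-- A polynomial in a single variable as a univariate polynomial. -/
noncomputable def toPoly : MvPolynomial (Fin 1) K →ₐ[K] Polynomial K :=
  aeval fun _ ↦ Polynomial.X

lemma coeff_toPoly (f : MvPolynomial (Fin 1) K) (i : ℕ) :
    (toPoly f).coeff i = coeff (Finsupp.single 0 i) f := by
  classical
  induction f using MvPolynomial.induction_on' with
  | add p q hp hq => rw [map_add, Polynomial.coeff_add, hp, hq, coeff_add]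
  | monomial S c =>
    have hS : S = Finsupp.single 0 (S 0) := by
      refine Finsupp.ext fun x ↦ ?_
      rw [Subsingleton.elim x 0]; simp
    rw [hS]
    generalize S 0 = s
    rw [toPoly, aeval_monomial, coeff_monomial, Polynomial.algebraMap_eq,
      Polynomial.coeff_C_mul]
    simp only [Finsupp.prod_single_index, pow_zero, Polynomial.coeff_X_pow]
    by_cases h : i = s
    · simp [h]
    · have : ¬ Finsupp.single (0 : Fin 1) s = Finsupp.single 0 i := fun h' ↦
        h (Finsupp.single_injective _ h').symm
      simp [h, this]

lemma toPoly_translate (β : Fin 1 → K) (f : MvPolynomial (Fin 1) K) :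
    toPoly (translate β f) = (toPoly f).comp (Polynomial.X + Polynomial.C (β 0)) := by
  have h : toPoly.comp (translate β) =
      (Polynomial.aeval (Polynomial.X + Polynomial.C (β 0))).comp toPoly := by
    ext x
    rw [Subsingleton.elim x 0]
    simp [toPoly, translate]
  exact DFunLike.congr_fun h f

variable [AdmissibleAbsValues K]

/-- The order of vanishing of a univariate polynomial at a point is bounded in terms of heights. -/
theorem exists_coeff_translate_ne_zero_univariate {V : MvPolynomial (Fin 1) K} (hV : V ≠ 0)
    {d : ℕ} (hd : V.degreeOf 0 ≤ d) (β : Fin 1 → K) :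
    ∃ J, coeff J (translate β V) ≠ 0 ∧
      J 0 * logHeight₁ (β 0) ≤ coeffHeight V + totalWeight K * (d * Real.log 2) := by
  classical
  set p := toPoly V with hpdef
  have hcoeff (i : ℕ) := coeff_toPoly V i
  have hp0 : p ≠ 0 := by
    obtain ⟨S, hS⟩ := support_nonempty.mpr hV
    intro h
    have hS' : S = Finsupp.single 0 (S 0) := by
      refine Finsupp.ext fun x ↦ ?_
      rw [Subsingleton.elim x 0]; simp
    have := hcoeff (S 0)
    rw [← hS', ← hpdef, h, Polynomial.coeff_zero] at this
    exact mem_support_iff.mp hS this.symm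
  have hpd : p.natDegree ≤ d := by
    refine Polynomial.natDegree_le_iff_coeff_eq_zero.mpr fun i hi ↦ ?_
    rw [hcoeff]
    by_contra h
    have := degreeOf_le_iff.mp hd _ (mem_support_iff.mpr h)
    simp at this
    omega
  set l := p.rootMultiplicity (β 0)
  obtain ⟨q, hq, hqroot⟩ := p.exists_eq_pow_rootMultiplicity_mul_and_not_dvd hp0 (β 0)
  rw [Polynomial.dvd_iff_isRoot, Polynomial.IsRoot.def] at hqroot
  change p = (Polynomial.X - Polynomial.C (β 0)) ^ l * q at hq
  refine ⟨Finsupp.single 0 l, ?_, ?_⟩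
  · rw [← coeff_toPoly, toPoly_translate, ← hpdef, hq]
    simp only [Polynomial.mul_comp, Polynomial.pow_comp, Polynomial.sub_comp, Polynomial.X_comp,
      Polynomial.C_comp, add_sub_cancel_right]
    rw [mul_comm, ← zero_add l, Polynomial.coeff_mul_X_pow']
    simpa [Polynomial.coeff_zero_eq_eval_zero] using hqroot
  · have hq0 : q ≠ 0 := by rintro rfl; simp at hqroot
    have hqf : (fun s : q.support ↦ q.coeff s) ≠ 0 := by
      obtain ⟨s, hs⟩ := Polynomial.support_nonempty.mpr hq0
      exact Function.ne_iff.mpr ⟨⟨s, hs⟩, Polynomial.mem_support_iff.mp hs⟩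
    have hβ0 : ![β 0 ^ l, 1] ≠ 0 := Function.ne_iff.mpr ⟨1, by simp⟩
    -- The tensor product of `(β ^ l, 1)` with the coefficients of `q` has height `l h(β) + h(q)`;
    -- the nonnegative `h(q)` is dropped later.
    have hprod := logHeight_fun_mul_eq hβ0 hqf
    rw [← logHeight₁_eq_logHeight, logHeight₁_pow] at hprod
    have hy0 : (fun a : Fin 2 × q.support ↦ ![β 0 ^ l, 1] a.1 * q.coeff a.2) ≠ 0 := by
      obtain ⟨s, hs⟩ := Function.ne_iff.mp hqf
      exact Function.ne_iff.mpr ⟨(1, s), by simpa using hs⟩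
    have hne : Nonempty (Fin 2 × q.support) := ⟨(Function.ne_iff.mp hy0).choose⟩
    have hcoef (v : AbsoluteValue K ℝ) (i : ℕ) : v (p.coeff i) ≤ gaussNorm v V := by
      rw [hcoeff]; exact apply_coeff_le_gaussNorm v V _
    have hle := logHeight_le_of_local (coeffFun_ne_zero hV) hy0 (C := 2 ^ d) (by positivity) 1
      (fun v _ ↦ ?_) fun v hv ↦ ?_
    · rw [hprod, Real.log_pow] at hle
      have := logHeight_nonneg fun s : q.support ↦ q.coeff s
      simp only [Finsupp.single_eq_same]
      rw [coeffHeight]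
      push_cast at hle
      linarith
    · rw [pow_one]
      refine ciSup_le fun a ↦ ?_
      have h0 := gaussNorm_nonneg v V
      have := coeff_div_le (v := v) (bd := fun s ↦ s * gaussNorm v V) (fun s ↦ by positivity)
        (fun s t hst ↦ mul_le_mul_of_nonneg_right (Nat.cast_le.mpr hst) h0)
        (fun x y s t hx hy ↦ (v.add_le x y).trans (by push_cast; linarith)) hpd
        (fun i ↦ by simpa using hcoef v i) hq a.2 a.1
      push_cast at this
      exact this
    · rw [pow_one]
      refine ciSup_le fun a ↦ ?_
      have h0 := gaussNorm_nonneg v V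
      have hv' := AdmissibleAbsValues.isNonarchimedean v hv
      -- In the ultrametric case the bound does not grow with the number of summands, so `2 ^ d` is
      -- lost only at archimedean places.
      have := coeff_div_le (v := v) (bd := fun s ↦ if s = 0 then 0 else gaussNorm v V)
        (fun s ↦ by split_ifs <;> simp [h0])
        (fun s t hst ↦ by
          dsimp only
          split_ifs with h1 h2 <;> first | omega | exact h0 | simp)
        (fun x y s t hx hy ↦ by
          refine (hv' x y).trans (max_le (hx.trans ?_) (hy.trans ?_)) <;> split_ifs <;>
            first | omega | exact h0 | simp)
        hpd (fun i ↦ by simpa using hcoef v i) hq a.2 a.1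
      rw [if_neg (by positivity)] at this
      exact this

end Univariate

end RothLemma

namespace RothLemma

open MvPolynomial Finset Height

/-! ### Elementary inequalities. -/

section Numeric

lemma sum_range_sub_div (θ ρ : ℝ) (N : ℕ) :
    ∑ a ∈ range N, (θ - a / ρ) = N * (θ - (N - 1) / (2 * ρ)) := by
  by_cases hρ : ρ = 0
  · simp [hρ]
  induction N with
  | zero => simp
  | succ N ih =>
    rw [Finset.sum_range_succ, ih]
    push_cast
    field_simp
    ring

/-- The first `N` terms, before truncation, form an arithmetic progression with mean at least `θ /
2`, because `N - 1 ≤ θ ρ`. -/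
lemma mul_half_le_sum_max {θ : ℝ} {ρ N n : ℕ} (hρ : 0 < ρ) (hN : (N : ℝ) ≤ θ * ρ + 1)
    (hNn : N ≤ n) : N * (θ / 2) ≤ ∑ a ∈ range n, max (θ - a / ρ) 0 := by
  have hρ' : (0 : ℝ) < ρ := by exact_mod_cast hρ
  calc N * (θ / 2) ≤ N * (θ - (N - 1) / (2 * ρ)) := by
        refine mul_le_mul_of_nonneg_left ?_ (Nat.cast_nonneg _)
        have : ((N : ℝ) - 1) / (2 * ρ) ≤ θ / 2 := by
          rw [div_le_iff₀ (by positivity)]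
          linarith
        linarith
    _ = ∑ a ∈ range N, (θ - a / ρ) := (sum_range_sub_div θ ρ N).symm
    _ ≤ ∑ a ∈ range N, max (θ - a / ρ) 0 := Finset.sum_le_sum fun a _ ↦ le_max_left _ _
    _ ≤ ∑ a ∈ range n, max (θ - a / ρ) 0 :=
        Finset.sum_le_sum_of_subset_of_nonneg (Finset.range_mono hNn) fun _ _ _ ↦ le_max_right _ _

/-- For `n ≤ θ ρ + 1` all terms are kept. Otherwise `⌊θ ρ⌋ + 1` terms are kept, and `n ≤ ρ + 1 ≤ 2
ρ` yields `θ² / 4` per column. -/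
lemma min_le_sum_max {θ : ℝ} (hθ : 0 ≤ θ) {ρ n : ℕ} (hρ : 0 < ρ) (hn : n ≤ ρ + 1) :
    n * min (θ / 2) (θ ^ 2 / 4) ≤ ∑ a ∈ range n, max (θ - a / ρ) 0 := by
  by_cases h : (n : ℝ) ≤ θ * ρ + 1
  · exact (mul_le_mul_of_nonneg_left (min_le_left _ _) (Nat.cast_nonneg _)).trans
      (mul_half_le_sum_max hρ h le_rfl)
  · rw [not_le] at h
    have h0 : 0 ≤ θ * ρ := by positivity
    have hf := Nat.floor_le h0
    have hf' := Nat.lt_floor_add_one (θ * ρ)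
    have hlt : ⌊θ * ρ⌋₊ + 1 ≤ n := by
      have : ((⌊θ * ρ⌋₊ : ℝ)) + 1 ≤ n := by linarith
      exact_mod_cast this
    have key := mul_half_le_sum_max (θ := θ) (N := ⌊θ * ρ⌋₊ + 1) hρ (by push_cast; linarith) hlt
    refine le_trans ?_ key
    have hn' : (n : ℝ) ≤ 2 * ρ := by
      have : n ≤ 2 * ρ := by omega
      exact_mod_cast this
    calc (n : ℝ) * min (θ / 2) (θ ^ 2 / 4) ≤ 2 * ρ * (θ ^ 2 / 4) :=
          mul_le_mul hn' (min_le_right _ _) (by positivity) (by positivity)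
      _ = (θ * ρ) * (θ / 2) := by ring
      _ ≤ _ := by
          push_cast
          exact mul_le_mul_of_nonneg_right hf'.le (by positivity)

/-- The minimum in `min_le_sum_max` gives two cases: `θ / 2` is settled by `η ≤ 1 / 2`, and `θ² / 4`
by `2 ≤ M`. -/
lemma le_of_sum_max_le {θ η M : ℝ} (hη0 : 0 < η) (hη : η ≤ 1 / 2) (hM : 2 ≤ M) {ρ n : ℕ}
    (hρ : 0 < ρ) (hn0 : 0 < n) (hn : n ≤ ρ + 1)
    (h : ∑ a ∈ range n, max (θ - a / ρ) 0 ≤ n * (2 * M * η ^ 2)) : θ ≤ 2 * M * η := by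
  by_contra! hcon
  have hθ : 0 < θ := lt_trans (by positivity) hcon
  have h1 := (min_le_sum_max hθ.le hρ hn).trans h
  have h2 := le_of_mul_le_mul_left h1 (by exact_mod_cast hn0)
  rcases min_le_iff.mp h2 with h3 | h3
  · have : 2 * M * η ^ 2 ≤ M * η := by nlinarith [mul_pos (show 0 < M by linarith) hη0]
    linarith
  · have h4 : (2 * M * η) ^ 2 < θ ^ 2 := pow_lt_pow_left₀ hcon (by positivity) two_ne_zero
    have h5 : 2 * M * η ^ 2 * 4 ≤ (2 * M * η) ^ 2 := by
      have : 0 ≤ M * (M - 2) * η ^ 2 := by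
        have : 0 ≤ M - 2 := by linarith
        positivity
      nlinarith
    linarith

/-- Use `n! ≤ n ^ n` with `n ≤ ρ + 1 ≤ 2 ^ ρ`, then `(1/4 + 4/3) log 2 < 2`. -/
lemma log_factorial_mul_pow_le {n ρ S : ℕ} {R : ℝ} (hn0 : 0 < n) (hn : n ≤ ρ + 1)
    (hρ : (ρ : ℝ) ≤ R / 4) (hS : (S : ℝ) ≤ 4 / 3 * R) :
    Real.log (n.factorial * (2 ^ S) ^ n) ≤ n * (2 * R) := by
  have hlog2 := Real.log_two_lt_d9
  have hlog2' : 0 < Real.log 2 := Real.log_pos one_lt_two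
  have hfac : Real.log n.factorial ≤ n * (ρ * Real.log 2) := by
    have h1 : n.factorial ≤ (2 ^ ρ) ^ n :=
      (Nat.factorial_le_pow n).trans (Nat.pow_le_pow_left (hn.trans Nat.lt_two_pow_self) n)
    have h2 : (n.factorial : ℝ) ≤ (2 ^ ρ) ^ n := by exact_mod_cast h1
    have := Real.log_le_log (by positivity) h2
    rwa [Real.log_pow, Real.log_pow] at this
  rw [Real.log_mul (by positivity) (by positivity), Real.log_pow, Real.log_pow]
  have hn' : (0 : ℝ) < n := by exact_mod_cast hn0
  have hR : 0 ≤ R := by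
    have : (0 : ℝ) ≤ ρ := Nat.cast_nonneg _
    linarith
  have : (ρ : ℝ) * Real.log 2 + S * Real.log 2 ≤ 2 * R := by
    have h1 : ((ρ : ℝ) + S) * Real.log 2 ≤ (19 / 12 * R) * Real.log 2 :=
      mul_le_mul_of_nonneg_right (by linarith) hlog2'.le
    nlinarith
  calc _ ≤ n * (ρ * Real.log 2) + n * (S * Real.log 2) := by linarith
    _ = n * (ρ * Real.log 2 + S * Real.log 2) := by ring
    _ ≤ _ := mul_le_mul_of_nonneg_left this hn'.le

end Numeric

/-! ### Renaming variables. -/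

section Rename

variable {σ τ : Type*} {K : Type*} [Field K]

lemma translate_rename (e : σ → τ) (β : τ → K) (P : MvPolynomial σ K) :
    translate β (rename e P) = rename e (translate (β ∘ e) P) := by
  have h : (translate β).comp (rename e) = (rename e).comp (translate (β ∘ e)) := by
    ext x; simp [translate]
  exact DFunLike.congr_fun h P

lemma wt_mapDomain_equiv [Fintype σ] [Fintype τ] (e : σ ≃ τ) (w : τ → ℝ) (I : σ →₀ ℕ) :
    wt w (I.mapDomain e) = wt (w ∘ e) I := by
  rw [wt, wt, ← e.sum_comp]
  refine Finset.sum_congr rfl fun h _ ↦ ?_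
  rw [Finsupp.mapDomain_apply e.injective]
  rfl

lemma mapDomain_symm_mapDomain (e : σ ≃ τ) (I : τ →₀ ℕ) :
    (I.mapDomain e.symm).mapDomain e = I := by
  rw [← Finsupp.mapDomain_comp, e.self_comp_symm, Finsupp.mapDomain_id]

lemma coeff_rename_equiv (e : σ ≃ τ) (P : MvPolynomial σ K) (I : τ →₀ ℕ) :
    coeff I (rename e P) = coeff (I.mapDomain e.symm) P := by
  conv_lhs => rw [← mapDomain_symm_mapDomain e I]
  exact coeff_rename_mapDomain e e.injective P _

lemma coeffHeight_rename_equiv_le [AdmissibleAbsValues K] (e : σ ≃ τ) (P : MvPolynomial σ K) :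
    coeffHeight (rename e P) ≤ coeffHeight P := by
  have hmem (s : (rename e P).support) : (s : τ →₀ ℕ).mapDomain e.symm ∈ P.support := by
    rw [mem_support_iff, ← coeff_rename_equiv]
    exact mem_support_iff.mp s.2
  refine le_trans (le_of_eq ?_) (logHeight_comp_le
    (fun s : (rename e P).support ↦ (⟨_, hmem s⟩ : P.support)) fun s : P.support ↦ coeff s P)
  rw [coeffHeight]
  congr 1
  ext s
  exact coeff_rename_equiv e P s

end Rename

/-! ### Splitting off the last variable. -/

section Step

variable {K : Type*} [Field K] [CharZero K] [AdmissibleAbsValues K] {σ : Type*} [Fintype σ]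

/-- The Wronskian construction: a polynomial whose last variable is split off yields polynomials
`U` and `V` in disjoint sets of variables, of controlled degree and height, whose product has
large index wherever `P` does. -/
theorem exists_wronskian_factors {P : MvPolynomial (σ ⊕ Fin 1) K} (hP : P ≠ 0)
    {r : σ ⊕ Fin 1 → ℕ} (hdeg : ∀ h, P.degreeOf h ≤ r h) :
    ∃ n, 0 < n ∧ n ≤ r (Sum.inr 0) + 1 ∧ ∃ (U : MvPolynomial σ K) (V : MvPolynomial (Fin 1) K),
      U ≠ 0 ∧ V ≠ 0 ∧ (∀ h, U.degreeOf h ≤ n * r (Sum.inl h)) ∧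
      V.degreeOf 0 ≤ n * r (Sum.inr 0) ∧
      coeffHeight U + coeffHeight V ≤ n * coeffHeight P +
        totalWeight K * Real.log (n.factorial * (2 ^ (∑ h, r h)) ^ n) ∧
      ∀ (w : σ ⊕ Fin 1 → ℝ) (β : σ ⊕ Fin 1 → K) (θ ε : ℝ), (∀ h, 0 ≤ w h) → 0 ≤ ε →
        (∀ h, r (Sum.inr 0) * w (Sum.inl h) ≤ ε) → WtGE w θ (translate β P) →
        WtGE w (∑ b : Fin n, max (θ - ε - b * w (Sum.inr 0)) 0)
          (tmul (translate (β ∘ Sum.inl) U) (translate (β ∘ Sum.inr) V)) := by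
  classical
  obtain ⟨φ₀, ψ₀, h₀⟩ := exists_sum_tmul P (hdeg (Sum.inr 0))
  obtain ⟨n, hn, φ, ψ, hφ, hψ, hsum⟩ := exists_linearIndependent_sum tmul φ₀ ψ₀
  rw [h₀] at hsum
  have hn0 : 0 < n := by
    rcases Nat.eq_zero_or_pos n with rfl | h
    · exact absurd (by simpa using hsum.symm) hP
    · exact h
  obtain ⟨I, hI, hU⟩ := exists_det_hasse_ne_zero hφ
  obtain ⟨J, hJ, hV⟩ := exists_det_hasse_ne_zero hψ
  set U := (Matrix.of fun i j ↦ hasse (I i) (φ j)).det with hUdef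
  set V := (Matrix.of fun i j ↦ hasse (J i) (ψ j)).det with hVdef
  -- The entries involve only `P`, yet the decomposition of `P` factors `M` into the two Wronskian
  -- matrices.
  let M : Matrix (Fin n) (Fin n) (MvPolynomial (σ ⊕ Fin 1) K) :=
    Matrix.of fun a b ↦ hasse ((I a).sumElim (J b)) P
  have hM : M.det = tmul U V := by
    have : M = ((Matrix.of fun i j ↦ hasse (I i) (φ j)).map (rename Sum.inl)) *
        ((Matrix.of fun i j ↦ hasse (J i) (ψ j)).map (rename Sum.inr)).transpose := by
      ext1 a b
      simp only [M, Matrix.of_apply, Matrix.mul_apply, Matrix.map_apply, Matrix.transpose_apply]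
      rw [← hsum, map_sum]
      exact Finset.sum_congr rfl fun j _ ↦ by rw [hasse_tmul, tmul_apply]
    rw [this, Matrix.det_mul, Matrix.det_transpose, tmul_apply, hUdef, hVdef, AlgHom.map_det,
      AlgHom.map_det]
    rfl
  have hcoeffUV (A : σ →₀ ℕ) (B : Fin 1 →₀ ℕ) (hA : coeff A U ≠ 0) (hB : coeff B V ≠ 0) :
      coeff (A.sumElim B) M.det ≠ 0 := by
    rw [hM, coeff_tmul]; exact mul_ne_zero hA hB
  have hdegM (h : σ ⊕ Fin 1) (S : σ ⊕ Fin 1 →₀ ℕ) (hS : coeff S M.det ≠ 0) :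
      S h ≤ n * r h := by
    -- Weight `-1` on the variable `h` turns a lower bound for weights into an upper bound for
    -- degrees.
    have hM' : WtGE (fun g ↦ if g = h then (-1 : ℝ) else 0) (∑ _b : Fin n, (-(r h : ℝ))) M.det := by
      refine WtGE.det fun a b S hS ↦ ?_
      have hS' : coeff (S + (I a).sumElim (J b)) P ≠ 0 := by
        simp only [M, Matrix.of_apply, coeff_hasse] at hS
        exact right_ne_zero_of_mul hS
      have := degreeOf_le_iff.mp (hdeg h) _ (mem_support_iff.mpr hS')
      rw [Finsupp.add_apply] at this
      have hle : (S h : ℝ) ≤ r h := by exact_mod_cast (Nat.le_add_right _ _).trans this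
      simpa [wt] using hle
    have := hM' S hS
    simp only [sum_const, card_univ, Fintype.card_fin, smul_neg, nsmul_eq_mul, wt, mul_ite,
      mul_neg, mul_one, mul_zero, sum_ite_eq', mem_univ, if_true] at this
    have : (S h : ℝ) ≤ n * r h := by linarith
    exact_mod_cast this
  obtain ⟨A₀, hA₀⟩ := support_nonempty.mpr hU
  obtain ⟨B₀, hB₀⟩ := support_nonempty.mpr hV
  rw [mem_support_iff] at hA₀ hB₀
  have hW : M.det ≠ 0 := fun h ↦ hcoeffUV A₀ B₀ hA₀ hB₀ (by rw [h, coeff_zero])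
  refine ⟨n, hn0, hn, U, V, hU, hV, fun h ↦ ?_, ?_, ?_, ?_⟩
  · exact degreeOf_le_iff.mpr fun A hA ↦
      hdegM (Sum.inl h) _ (hcoeffUV A B₀ (mem_support_iff.mp hA) hB₀)
  · exact degreeOf_le_iff.mpr fun B hB ↦
      hdegM (Sum.inr 0) _ (hcoeffUV A₀ B hA₀ (mem_support_iff.mp hB))
  · refine (coeffHeight_add_le_tmul hU hV).trans ?_
    rw [← hM]
    exact coeffHeight_det_hasse_le hdeg (fun a b ↦ (I a).sumElim (J b)) hP hW
  · intro w β θ ε hw hε hwε hθ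
    rw [← translate_tmul, ← hM, AlgHom.map_det]
    refine WtGE.det fun a b ↦ ?_
    have hentry : ((translate β).mapMatrix M) a b =
        hasse ((I a).sumElim (J b)) (translate β P) := by
      rw [hasse_translate]; rfl
    rw [hentry]
    have hge := hθ.hasse hw ((I a).sumElim (J b))
    intro S hS
    refine le_trans ?_ (hge S hS)
    refine max_le_max ?_ le_rfl
    -- Row `a` has order at most `n - 1 ≤ r (Sum.inr 0)`, and each derivative costs at most `ε / r
    -- (Sum.inr 0)`; if that integer is zero, no derivative is taken.
    have h1 : wt (w ∘ Sum.inl) (I a) ≤ ε := by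
      have hdegI : (I a).degree ≤ r (Sum.inr 0) := (hI a).trans (by omega)
      rcases Nat.eq_zero_or_pos (r (Sum.inr 0)) with h0 | h0
      · have hIa : I a = 0 := by
          rw [← Finsupp.degree_eq_zero_iff]; omega
        simpa [hIa, wt] using hε
      · have hpos : (0 : ℝ) < r (Sum.inr 0) := by exact_mod_cast h0
        refine le_of_mul_le_mul_left ?_ hpos
        calc (r (Sum.inr 0) : ℝ) * wt (w ∘ Sum.inl) (I a)
            = ∑ h, (I a h : ℝ) * (r (Sum.inr 0) * w (Sum.inl h)) := by
              rw [wt, Finset.mul_sum]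
              exact Finset.sum_congr rfl fun h _ ↦ by simp only [Function.comp_apply]; ring
          _ ≤ ∑ h, (I a h : ℝ) * ε := Finset.sum_le_sum fun h _ ↦
              mul_le_mul_of_nonneg_left (hwε h) (Nat.cast_nonneg _)
          _ = ((I a).degree : ℝ) * ε := by
              rw [← Finset.sum_mul, Finsupp.degree_eq_sum]; push_cast; rfl
          _ ≤ r (Sum.inr 0) * ε :=
              mul_le_mul_of_nonneg_right (by exact_mod_cast hdegI) hε
    have h2 : wt (w ∘ Sum.inr) (J b) ≤ b * w (Sum.inr 0) := by
      have : (J b 0 : ℝ) ≤ b := by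
        have := hJ b
        rw [Finsupp.degree_eq_sum] at this
        exact_mod_cast (by simpa using this : J b 0 ≤ b)
      simpa [wt] using mul_le_mul_of_nonneg_right this (hw (Sum.inr 0))
    rw [wt_sumElim]
    linarith

end Step

end RothLemma

namespace RothLemma

open MvPolynomial Finset Height

/-! ### The induction on the number of variables. -/

section Induction

variable {K : Type*} [Field K] [AdmissibleAbsValues K]

lemma exists_order_le {V : MvPolynomial (Fin 1) K} (hV : V ≠ 0) {d : ℕ} (hd : V.degreeOf 0 ≤ d)
    {β : Fin 1 → K} (hβ : 0 < logHeight₁ (β 0)) {B : ℝ}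
    (hB : coeffHeight V + totalWeight K * d ≤ B * logHeight₁ (β 0)) :
    ∃ J, coeff J (translate β V) ≠ 0 ∧ J 0 ≤ B := by
  obtain ⟨J, hJ, hle⟩ := exists_coeff_translate_ne_zero_univariate hV hd β
  refine ⟨J, hJ, le_of_mul_le_mul_right (hle.trans (le_trans ?_ hB)) hβ⟩
  have : (d : ℝ) * Real.log 2 ≤ d :=
    mul_le_of_le_one_right (Nat.cast_nonneg _) (by linarith [Real.log_two_lt_d9])
  have := mul_le_mul_of_nonneg_left this (Nat.cast_nonneg (totalWeight K))
  linarith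

/-- The Roth lemma over a field with a product formula, for heights that are not normalized. -/
theorem exists_wt_le [CharZero K] (hT : 0 < totalWeight K) (m : ℕ) :
    ∀ (P : MvPolynomial (Fin (m + 1)) K) (r : Fin (m + 1) → ℕ) (β : Fin (m + 1) → K) (R η : ℝ),
      P ≠ 0 → (∀ h, 0 < r h) → (∀ h, P.degreeOf h ≤ r h) → (∀ h, (r h : ℝ) ≤ R) →
      (∑ h, (r h : ℝ)) ≤ 4 / 3 * R → 0 < η → η ≤ 1 / 2 →
      (∀ i j, i < j → (r j : ℝ) ≤ η ^ 2 ^ m * r i) →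
      (∀ h, coeffHeight P + 2 * (m + 1) * R * totalWeight K ≤
        η ^ 2 ^ m * (r h * logHeight₁ (β h))) →
      ∃ I, coeff I (translate β P) ≠ 0 ∧ wt (fun h ↦ 1 / (r h : ℝ)) I ≤ 2 * (m + 1) * η := by
  have hT' : (0 : ℝ) < totalWeight K := by exact_mod_cast hT
  have hpos {s a b c : ℝ} (hs : 0 < s) (ha : 0 < a) (hc : 0 < c) (h : c ≤ s * (a * b)) : 0 < b := by
    by_contra! hb
    have : s * (a * b) ≤ 0 :=
      mul_nonpos_of_nonneg_of_nonpos hs.le (mul_nonpos_of_nonneg_of_nonpos ha.le hb)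
    linarith
  induction m with
  | zero =>
    intro P r β R η hP hr hdeg hR _ hη0 hη _ hheight
    have hr0 : (0 : ℝ) < r 0 := by exact_mod_cast hr 0
    have hR0 : 0 < R := hr0.trans_le (hR 0)
    have hh := hheight 0
    simp only [Nat.cast_zero, zero_add, mul_one, pow_zero, pow_one] at hh ⊢
    have hP0 := coeffHeight_nonneg P
    have hRT : 0 < R * totalWeight K := mul_pos hR0 hT'
    have hβ := hpos hη0 hr0 (c := coeffHeight P + 2 * R * totalWeight K) (by linarith) hh
    have hrR := mul_le_mul_of_nonneg_right (hR 0) hT'.le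
    obtain ⟨J, hJ, hle⟩ := exists_order_le hP (hdeg 0) hβ (B := η * r 0) (by linarith)
    refine ⟨J, hJ, ?_⟩
    have : (J 0 : ℝ) / r 0 ≤ η := by rwa [div_le_iff₀ hr0]
    rw [wt, Fintype.sum_eq_single 0 fun x hx ↦ absurd (Fin.ext (by omega)) hx, mul_one_div]
    linarith
  | succ m ih =>
    intro P' r' β' R η hP' hr' hdeg' hR' hsum' hη0 hη hratio' hheight'
    set s := η ^ 2 ^ (m + 1) with hs
    have hs0 : 0 < s := pow_pos hη0 _
    have hsη : s ≤ η ^ 2 := by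
      refine pow_le_pow_of_le_one hη0.le (by linarith) ?_
      calc 2 = 2 ^ 1 := rfl
        _ ≤ 2 ^ (m + 1) := Nat.pow_le_pow_right two_pos (by omega)
    have hη2 : η ^ 2 ≤ 1 / 4 := by nlinarith
    let e : Fin (m + 1) ⊕ Fin 1 ≃ Fin (m + 1 + 1) := finSumFinEquiv
    let P := rename e.symm P'
    let r := r' ∘ e
    let β := β' ∘ e
    set ρ := r (Sum.inr 0) with hρdef
    have hP : P ≠ 0 := fun h ↦ hP' (rename_injective e.symm e.symm.injective (by simpa using h))
    have hdeg (h : Fin (m + 1) ⊕ Fin 1) : P.degreeOf h ≤ r h := by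
      have := degreeOf_rename_of_injective (p := P') e.symm.injective (e h)
      rw [e.symm_apply_apply] at this
      exact this.le.trans (hdeg' (e h))
    have hr (h : Fin (m + 1) ⊕ Fin 1) : (0 : ℝ) < r h := by exact_mod_cast hr' (e h)
    have hR (h : Fin (m + 1) ⊕ Fin 1) : (r h : ℝ) ≤ R := hR' (e h)
    have hR0 : 0 < R := (hr (Sum.inr 0)).trans_le (hR _)
    have hsum : ∑ h, (r h : ℝ) ≤ 4 / 3 * R :=
      (e.sum_comp fun h ↦ (r' h : ℝ)).le.trans hsum'
    have hlast (h : Fin (m + 1)) : (ρ : ℝ) ≤ s * r (Sum.inl h) := by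
      refine hratio' _ _ ?_
      simp only [e, finSumFinEquiv_apply_left, finSumFinEquiv_apply_right, Fin.lt_def,
        Fin.val_castAdd, Fin.val_natAdd]
      omega
    have hheight (h : Fin (m + 1) ⊕ Fin 1) : coeffHeight P + 2 * (m + 2) * R * totalWeight K ≤
        s * (r h * logHeight₁ (β h)) := by
      have h1 := hheight' (e h)
      have h2 := coeffHeight_rename_equiv_le e.symm P'
      push_cast at h1
      have h3 : (2 : ℝ) * (m + 1 + 1) = 2 * (m + 2) := by ring
      rw [h3] at h1
      exact (add_le_add_left h2 _).trans h1
    have hβpos (h : Fin (m + 1) ⊕ Fin 1) : 0 < logHeight₁ (β h) := by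
      refine hpos hs0 (hr h) (c := coeffHeight P + 2 * (m + 2) * R * totalWeight K) ?_ (hheight h)
      have := coeffHeight_nonneg P
      positivity
    obtain ⟨n, hn0, hn, U, V, hU, hV, hUdeg, hVdeg, hUV, hindex⟩ := exists_wronskian_factors hP hdeg
    have hn0' : (0 : ℝ) < n := by exact_mod_cast hn0
    have hρ4 : (ρ : ℝ) ≤ R / 4 := by
      have h1 := hlast 0
      have h2 := hR (Sum.inl 0)
      have h3 := (hr (Sum.inl 0)).le
      nlinarith
    have hρ0 : 0 < ρ := hr' _
    have hρ0' : (0 : ℝ) < ρ := hr (Sum.inr 0)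
    have hUV' : coeffHeight U + coeffHeight V ≤ n * (coeffHeight P + 2 * R * totalWeight K) := by
      have hlog := log_factorial_mul_pow_le (S := ∑ h, r h) hn0 hn hρ4 (by push_cast; exact hsum)
      have := mul_le_mul_of_nonneg_left hlog hT'.le
      linarith
    have hU0 := coeffHeight_nonneg U
    have hV0 := coeffHeight_nonneg V
    have hRT : 0 < R * totalWeight K := mul_pos hR0 hT'
    have hmRT : 0 ≤ m * (R * totalWeight K) := by positivity
    -- With `η²` for `η` the number `s` is unchanged, since `(η²) ^ 2 ^ m = η ^ 2 ^ (m + 1)`. All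
    -- data scale by `n`, and the extra `2 R` in `hUV'` is paid for by passing from `2 (m + 2)` to
    -- `2 (m + 1)`.
    obtain ⟨A, hA, hAwt⟩ := ih U (fun h ↦ n * r (Sum.inl h)) (β ∘ Sum.inl) (n * R) (η ^ 2) hU
      (fun h ↦ Nat.mul_pos hn0 (hr' _)) hUdeg
      (fun h ↦ by push_cast; exact mul_le_mul_of_nonneg_left (hR _) hn0'.le)
      (by
        push_cast
        rw [← Finset.mul_sum]
        have h1 : ∑ h : Fin (m + 1), (r (Sum.inl h) : ℝ) ≤ 4 / 3 * R := by
          rw [Fintype.sum_sum_type] at hsum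
          have : (0 : ℝ) ≤ ∑ h : Fin 1, (r (Sum.inr h) : ℝ) := by positivity
          linarith
        nlinarith)
      (by positivity) (by linarith)
      (fun i j hij ↦ by
        push_cast
        rw [← pow_mul, ← pow_succ', ← hs]
        have := hratio' (e (Sum.inl i)) (e (Sum.inl j)) (by
          simp only [e, finSumFinEquiv_apply_left, Fin.lt_def, Fin.val_castAdd]
          exact hij)
        calc (n : ℝ) * r (Sum.inl j) ≤ n * (s * r (Sum.inl i)) :=
              mul_le_mul_of_nonneg_left this hn0'.le
          _ = s * (n * r (Sum.inl i)) := by ring)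
      (fun h ↦ by
        push_cast
        rw [← pow_mul, ← pow_succ', ← hs]
        have := mul_le_mul_of_nonneg_left (hheight (Sum.inl h)) hn0'.le
        calc coeffHeight U + 2 * (m + 1) * (n * R) * totalWeight K
            ≤ n * (coeffHeight P + 2 * (m + 2) * R * totalWeight K) := by linarith
          _ ≤ n * (s * (r (Sum.inl h) * logHeight₁ (β (Sum.inl h)))) := this
          _ = _ := by simp only [Function.comp_apply]; ring)
    obtain ⟨B, hB, hBle⟩ := exists_order_le hV hVdeg (β := β ∘ Sum.inr) (hβpos (Sum.inr 0))
      (B := n * (s * ρ)) (by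
        have h1 := mul_le_mul_of_nonneg_left (hheight (Sum.inr 0)) hn0'.le
        have h2 : (totalWeight K : ℝ) * ρ ≤ R * totalWeight K := by
          rw [mul_comm]
          exact mul_le_mul_of_nonneg_right (hR _) hT'.le
        have h3 := mul_le_mul_of_nonneg_left h2 hn0'.le
        have h4 := mul_nonneg hn0'.le hmRT
        have h5 := mul_pos hn0' hRT
        push_cast
        calc coeffHeight V + totalWeight K * (n * ρ)
            ≤ n * (coeffHeight P + 2 * (m + 2) * R * totalWeight K) := by linarith
          _ ≤ _ := h1
          _ = _ := by simp only [Function.comp_apply]; ring)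
    obtain ⟨S₀, hS₀, hmin⟩ := Finset.exists_min_image (translate β P).support
      (wt fun h ↦ 1 / (r h : ℝ)) (support_nonempty.mpr fun h ↦
        hP (translate_injective β (by rw [h, map_zero])))
    set θ := wt (fun h ↦ 1 / (r h : ℝ)) S₀ with hθdef
    have hge := hindex (fun h ↦ 1 / (r h : ℝ)) β θ s (fun h ↦ by positivity) hs0.le
      (fun h ↦ by
        rw [mul_one_div, div_le_iff₀ (hr _)]
        exact hlast h)
      (fun I hI ↦ hmin I (mem_support_iff.mpr hI)) (A.sumElim B)
      (by rw [coeff_tmul]; exact mul_ne_zero hA hB)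
    rw [wt_sumElim] at hge
    have hA' : wt ((fun h ↦ 1 / (r h : ℝ)) ∘ Sum.inl) A ≤ n * (2 * (m + 1) * η ^ 2) := by
      refine le_trans (le_of_eq ?_) (mul_le_mul_of_nonneg_left hAwt hn0'.le)
      rw [wt, wt, Finset.mul_sum]
      refine Finset.sum_congr rfl fun h _ ↦ ?_
      have := (hr (Sum.inl h)).ne'
      push_cast
      simp only [Function.comp_apply]
      field_simp
    have hB' : wt ((fun h ↦ 1 / (r h : ℝ)) ∘ Sum.inr) B ≤ n * s := by
      have h1 : (B 0 : ℝ) / ρ ≤ n * s := by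
        rw [div_le_iff₀ hρ0']; linarith
      simpa [wt, div_eq_mul_inv] using h1
    have hθle : θ ≤ 2 * ((m : ℝ) + 2) * η := by
      refine le_of_sum_max_le hη0 hη (by linarith [(Nat.cast_nonneg m : (0 : ℝ) ≤ m)]) hρ0 hn0 hn ?_
      rw [← Fin.sum_univ_eq_sum_range fun a ↦ max (θ - (a : ℝ) / ρ) 0]
      -- Undoing the shift costs `s` per column and `V` contributes another `n s`. As `s ≤ η²`, the
      -- total is at most `n * 2 (m + 2) η²`.
      have h1 : ∑ b : Fin n, max (θ - (b : ℝ) / ρ) 0 ≤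
          ∑ b : Fin n, (max (θ - s - b * (1 / (ρ : ℝ))) 0 + s) := by
        refine Finset.sum_le_sum fun b _ ↦ max_le ?_ ?_
        · have := le_max_left (θ - s - (b : ℝ) * (1 / (ρ : ℝ))) 0
          rw [mul_one_div] at this ⊢
          linarith
        · have := le_max_right (θ - s - (b : ℝ) * (1 / (ρ : ℝ))) 0
          linarith
      rw [Finset.sum_add_distrib, Finset.sum_const, Finset.card_univ, Fintype.card_fin,
        nsmul_eq_mul] at h1
      have h2 := mul_le_mul_of_nonneg_left hsη hn0'.le
      linarith
    refine ⟨S₀.mapDomain e, ?_, ?_⟩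
    · have : translate β' P' = rename e (translate β P) := by
        rw [← translate_rename, rename_rename]
        simp
      rw [this, coeff_rename_mapDomain e e.injective]
      exact mem_support_iff.mp hS₀
    · rw [wt_mapDomain_equiv]
      push_cast
      refine le_trans hθle (le_of_eq ?_)
      ring

end Induction

/-! ### Passage to absolute heights over the algebraic numbers. -/

section Transfer

open NumberField

theorem logHeight_div_finrank {F L : Type*} [Field F] [NumberField F] [Field L] [NumberField L]
    [Algebra F L] {ι : Type*} [Finite ι] (x : ι → F) :
    logHeight (fun i ↦ algebraMap F L (x i)) =
      Module.finrank ℚ L * (logHeight x / Module.finrank ℚ F) := by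
  have h1 : (Module.finrank ℚ F : ℝ) * Module.finrank F L = Module.finrank ℚ L := by
    exact_mod_cast Module.finrank_mul_finrank ℚ F L
  have h2 : (Module.finrank ℚ F : ℝ) ≠ 0 := by
    exact_mod_cast (Module.finrank_pos (R := ℚ) (M := F)).ne'
  rw [logHeight_algebraMap, ← h1]
  field_simp

/-- The absolute height is computed in `ℚ(x)`, and the height divided by the degree does not change
along `ℚ(x) ⊆ K`. -/
lemma logHeight₁_eq_finrank_mul (K : IntermediateField ℚ QBar) [NumberField K] (x : K) :
    logHeight₁ x = Module.finrank ℚ K * absLogHeight₁ (x : QBar) := by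
  have hint : IsIntegral ℚ (x : QBar) := isIntegral_QBar _
  have : FiniteDimensional ℚ (IntermediateField.adjoin ℚ {(x : QBar)}) :=
    IntermediateField.adjoin.finiteDimensional hint
  have : NumberField (IntermediateField.adjoin ℚ {(x : QBar)}) := {}
  have hle : IntermediateField.adjoin ℚ {(x : QBar)} ≤ K :=
    IntermediateField.adjoin_le_iff.mpr (by simp)
  let _ := (IntermediateField.inclusion hle).toRingHom.toAlgebra
  have h := logHeight_div_finrank (L := K) ![IntermediateField.AdjoinSimple.gen ℚ (x : QBar), 1]
  have hvec : (fun i ↦ algebraMap (IntermediateField.adjoin ℚ {(x : QBar)}) K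
      (![IntermediateField.AdjoinSimple.gen ℚ (x : QBar), 1] i)) = ![x, 1] := by
    ext i
    fin_cases i
    · rfl
    · simp
  rw [hvec, ← logHeight₁_eq_logHeight, ← logHeight₁_eq_logHeight] at h
  rw [h, absLogHeight₁, absMulHeight₁, dif_pos hint, Real.log_rpow (mulHeight₁_pos _),
    logHeight₁_eq_log_mulHeight₁, inv_mul_eq_div]

lemma coeffHeight_eq_finrank_mul (K : IntermediateField ℚ QBar) [NumberField K] {m : ℕ}
    (P : MvPolynomial (Fin m) K) :
    coeffHeight P = Module.finrank ℚ K * polyHeight (map (algebraMap K QBar) P) := by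
  set Q := map (algebraMap K QBar) P with hQ
  have hle : coeffField Q ≤ K := by
    refine IntermediateField.adjoin_le_iff.mpr fun c hc ↦ ?_
    obtain ⟨s, hs, rfl⟩ := mem_coeffs_iff.mp (Finset.mem_coe.mp hc)
    rw [hQ, coeff_map]
    exact (coeff s P).2
  let _ := (IntermediateField.inclusion hle).toRingHom.toAlgebra
  have hsupp : P.support = Q.support :=
    (support_map_of_injective P (algebraMap K QBar).injective).symm
  rw [polyHeight, ← logHeight_div_finrank (L := K), coeffHeight,
    ← logHeight_comp_equiv (Equiv.subtypeEquivRight fun s ↦ by rw [hsupp] :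
      Q.support ≃ P.support)]
  congr 1

lemma map_translate {σ F L : Type*} [Field F] [Field L] (f : F →+* L) (β : σ → F)
    (P : MvPolynomial σ F) : map f (translate β P) = translate (f ∘ β) (map f P) := by
  induction P using MvPolynomial.induction_on with
  | C a => simp [translate, algebraMap_eq]
  | add p q hp hq => simp [hp, hq]
  | mul_X p g hp => rw [map_mul, map_mul, hp, map_mul, map_mul]; simp [translate]

/-- The term `f k / 3` is the full geometric tail of ratio `1/4` after `f k`; carrying it makes the
induction close. -/
lemma sum_range_add_le {f : ℕ → ℝ} (hf : ∀ j, f (j + 1) ≤ f j / 4) (k : ℕ) :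
    ∑ j ∈ range (k + 1), f j + f k / 3 ≤ 4 / 3 * f 0 := by
  induction k with
  | zero => simp; linarith
  | succ k ih =>
    rw [Finset.sum_range_succ]
    linarith [hf k]

lemma sum_le_of_ratio_le {m : ℕ} {r : Fin (m + 1) → ℝ} (hr : ∀ h, 0 ≤ r h)
    (h : ∀ (j : ℕ) (hj : j + 1 < m + 1), r ⟨j + 1, hj⟩ ≤ r ⟨j, Nat.lt_of_succ_lt hj⟩ / 4) :
    ∑ i, r i ≤ 4 / 3 * r 0 := by
  let f (j : ℕ) : ℝ := if hj : j < m + 1 then r ⟨j, hj⟩ else 0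
  have hf0 (j : ℕ) : 0 ≤ f j := by
    simp only [f]; split_ifs
    · exact hr _
    · exact le_rfl
  have hf (j : ℕ) : f (j + 1) ≤ f j / 4 := by
    by_cases hj : j + 1 < m + 1
    · simp only [f, dif_pos hj, dif_pos (Nat.lt_of_succ_lt hj)]
      exact h j hj
    · have : f (j + 1) = 0 := dif_neg hj
      rw [this]
      exact div_nonneg (hf0 j) (by norm_num)
  have h1 := sum_range_add_le hf m
  rw [← Fin.sum_univ_eq_sum_range] at h1
  have h2 : ∑ i : Fin (m + 1), f i = ∑ i, r i :=
    Finset.sum_congr rfl fun i _ ↦ dif_pos i.2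
  have h3 : f 0 = r 0 := dif_pos (Nat.succ_pos m)
  rw [h2, h3] at h1
  linarith [hf0 m]

lemma le_mul_of_lt_of_ratio_le {m : ℕ} {r : Fin (m + 1) → ℝ} (hr : ∀ h, 0 ≤ r h) {s : ℝ}
    (hs0 : 0 ≤ s) (hs1 : s ≤ 1)
    (h : ∀ (j : ℕ) (hj : j + 1 < m + 1), r ⟨j + 1, hj⟩ ≤ s * r ⟨j, Nat.lt_of_succ_lt hj⟩)
    {i j : Fin (m + 1)} (hij : i < j) : r j ≤ s * r i := by
  suffices H : ∀ (k : ℕ) (hk : i + k + 1 < m + 1), r ⟨i + k + 1, hk⟩ ≤ s * r i by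
    have hj : (i : ℕ) + (j - i - 1) + 1 = j := by
      have : (i : ℕ) < j := hij
      omega
    have := H (j - i - 1) (by omega)
    simpa only [hj] using this
  intro k
  induction k with
  | zero => exact fun hk ↦ h i hk
  | succ k ih =>
    intro hk
    refine (h (i + k + 1) hk).trans (mul_le_mul_of_nonneg_left ((ih _).trans ?_) hs0)
    exact mul_le_of_le_one_left (hr i) hs1

/-- **Roth lemma**. -/
theorem index_le (m : ℕ) (hm : 0 < m)
    (P : MvPolynomial (Fin m) (AlgebraicClosure ℚ)) (hP : P ≠ 0)
    (r : Fin m → ℕ) (hr : ∀ h, 0 < r h) (hdeg : ∀ h, P.degreeOf h ≤ r h)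
    (β : Fin m → AlgebraicClosure ℚ)
    (η : ℝ) (hη0 : 0 < η) (hη : η ≤ 1 / 2)
    (hratio : ∀ (j : ℕ) (hj : j + 1 < m),
      (r ⟨j + 1, hj⟩ : ℝ) / (r ⟨j, Nat.lt_of_succ_lt hj⟩ : ℝ) ≤ η ^ (2 ^ (m - 1)))
    (hheight : RothLemma.polyHeight P + 2 * (m : ℝ) * (r ⟨0, hm⟩ : ℝ) ≤
      η ^ (2 ^ (m - 1)) * ⨅ h : Fin m, (r h : ℝ) * NumberField.absLogHeight₁ (β h)) :
    RothLemma.index β r P ≤ 2 * (m : ℝ) * η := by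
  obtain ⟨m, rfl⟩ : ∃ k, m = k + 1 := ⟨m - 1, by omega⟩
  rw [Nat.add_sub_cancel] at hratio hheight
  set s := η ^ 2 ^ m with hs
  have hs0 : 0 < s := pow_pos hη0 _
  have hs1 : s ≤ 1 := pow_le_one₀ hη0.le (by linarith)
  have hr' (h : Fin (m + 1)) : (0 : ℝ) < r h := by exact_mod_cast hr h
  have hstep (j : ℕ) (hj : j + 1 < m + 1) :
      (r ⟨j + 1, hj⟩ : ℝ) ≤ s * r ⟨j, Nat.lt_of_succ_lt hj⟩ :=
    (div_le_iff₀ (hr' _)).mp (hratio j hj)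
  have hlt (i j : Fin (m + 1)) (hij : i < j) : (r j : ℝ) ≤ s * r i :=
    le_mul_of_lt_of_ratio_le (fun h ↦ (hr' h).le) hs0.le hs1 hstep hij
  have hmax (h : Fin (m + 1)) : (r h : ℝ) ≤ r 0 := by
    rcases (Fin.zero_le h).eq_or_lt with rfl | h0
    · exact le_rfl
    · exact (hlt 0 h h0).trans (mul_le_of_le_one_left (hr' 0).le hs1)
  have hsum : ∑ h, (r h : ℝ) ≤ 4 / 3 * r 0 := by
    refine sum_le_of_ratio_le (fun h ↦ (hr' h).le) fun j hj ↦ (hstep j hj).trans ?_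
    -- The index `j` exists only if `1 ≤ m`, so the exponent is at least two; with one variable
    -- nothing is needed.
    have hs4 : s ≤ 1 / 4 := by
      calc s ≤ η ^ 2 := pow_le_pow_of_le_one hη0.le (by linarith)
            (Nat.pow_le_pow_right two_pos (show 1 ≤ m by omega))
        _ ≤ 1 / 4 := by nlinarith
    linarith [mul_le_mul_of_nonneg_right hs4 (hr' ⟨j, Nat.lt_of_succ_lt hj⟩).le]
  -- The induction needs one field containing the coefficients and the point, larger in general than
  -- the field used by `polyHeight`.
  obtain ⟨K, _, hPK, hβK⟩ : ∃ (K : IntermediateField ℚ QBar) (_ : NumberField K),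
      (P.coeffs : Set QBar) ⊆ Set.range (algebraMap K QBar) ∧ ∀ h, β h ∈ K := by
    have : FiniteDimensional ℚ
        (IntermediateField.adjoin ℚ ((P.coeffs : Set QBar) ∪ Set.range β)) :=
      IntermediateField.finiteDimensional_adjoin fun x _ ↦ isIntegral_QBar x
    refine ⟨IntermediateField.adjoin ℚ ((P.coeffs : Set QBar) ∪ Set.range β), {},
      fun c hc ↦ ⟨⟨c, IntermediateField.subset_adjoin ℚ _ (Or.inl hc)⟩, rfl⟩,
      fun h ↦ IntermediateField.subset_adjoin ℚ _ (Or.inr ⟨h, rfl⟩)⟩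
  obtain ⟨Q, rfl⟩ : ∃ Q : MvPolynomial (Fin (m + 1)) K, map (algebraMap K QBar) Q = P :=
    (mem_range_map_iff_coeffs_subset (f := algebraMap K QBar)).mpr hPK
  let γ (h : Fin (m + 1)) : K := ⟨β h, hβK h⟩
  have hinj := (algebraMap K QBar).injective
  have hN : (0 : ℝ) < Module.finrank ℚ K := by
    exact_mod_cast Module.finrank_pos (R := ℚ) (M := K)
  obtain ⟨I, hI, hwt⟩ := exists_wt_le (NumberField.totalWeight_pos K) m Q r γ (r 0) η
    (fun h ↦ hP (by rw [h, map_zero])) hr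
    (fun h ↦ by
      refine degreeOf_le_iff.mpr fun t ht ↦ degreeOf_le_iff.mp (hdeg h) t ?_
      rwa [support_map_of_injective Q hinj])
    hmax hsum hη0 hη hlt
    (fun h ↦ by
      have h1 : s * (⨅ h, (r h : ℝ) * NumberField.absLogHeight₁ (β h)) ≤
          s * (r h * NumberField.absLogHeight₁ (β h)) :=
        mul_le_mul_of_nonneg_left (Finite.ciInf_le _ h) hs0.le
      have h2 := mul_le_mul_of_nonneg_left (hheight.trans h1) hN.le
      have h3 := logHeight₁_eq_finrank_mul K (γ h)
      rw [NumberField.totalWeight_eq_finrank, coeffHeight_eq_finrank_mul, h3]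
      push_cast at h2
      calc _ = Module.finrank ℚ K * (polyHeight (map (algebraMap K QBar) Q) +
            2 * ((m : ℝ) + 1) * r 0) := by ring
        _ ≤ _ := h2
        _ = _ := by ring)
  have hmem : ∑ h, (I h : ℝ) / r h ∈ {t : ℝ | ∃ I : Fin (m + 1) → ℕ,
      eval β (dividedDeriv I (map (algebraMap K QBar) Q)) ≠ 0 ∧
        t = ∑ h, (I h : ℝ) / (r h : ℝ)} := by
    refine ⟨I, ?_, rfl⟩
    rw [dividedDeriv_eq_hasse, ← coeff_translate]
    have hγ : algebraMap K QBar ∘ γ = β := rfl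
    have htr := map_translate (algebraMap K QBar) γ Q
    rw [hγ] at htr
    have hI' : Finsupp.equivFunOnFinite.symm (I : Fin (m + 1) → ℕ) = I := by ext; rfl
    rw [hI', ← htr, coeff_map]
    exact (map_ne_zero_iff _ hinj).mpr hI
  refine (csInf_le ⟨0, ?_⟩ hmem).trans ?_
  · rintro t ⟨J, -, rfl⟩
    positivity
  · push_cast
    simpa only [wt, mul_one_div] using hwt

end Transfer

end RothLemma

theorem mainTheorem5 (m : ℕ) (hm : 0 < m)
    (P : MvPolynomial (Fin m) (AlgebraicClosure ℚ)) (hP : P ≠ 0)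
    (r : Fin m → ℕ) (hr : ∀ h, 0 < r h) (hdeg : ∀ h, P.degreeOf h ≤ r h)
    (β : Fin m → AlgebraicClosure ℚ)
    (η : ℝ) (hη0 : 0 < η) (hη : η ≤ 1 / 2)
    (hratio : ∀ (j : ℕ) (hj : j + 1 < m),
      (r ⟨j + 1, hj⟩ : ℝ) / (r ⟨j, Nat.lt_of_succ_lt hj⟩ : ℝ) ≤ η ^ (2 ^ (m - 1)))
    (hheight : RothLemma.polyHeight P + 2 * (m : ℝ) * (r ⟨0, hm⟩ : ℝ) ≤
      η ^ (2 ^ (m - 1)) * ⨅ h : Fin m, (r h : ℝ) * NumberField.absLogHeight₁ (β h)) :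
    RothLemma.index β r P ≤ 2 * (m : ℝ) * η :=
  RothLemma.index_le m hm P hP r hr hdeg β η hη0 hη hratio hheight
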